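/- **Setting.** Call a function $F$ a *stable* transfer function if there are $\varepsilon>0$ and a real signed Borel measure $\mu$ on $[0,\infty)$ (the impulse response) with $\int e^{\varepsilon t}\,d|\mu|(t)<\infty$ such that $F(s)=\int_{[0,\infty)}e^{-st}\,d\mu(t)$ for $\operatorname{Re}s\ge 0$, $s\neq 0$; in particular $F$ is proper and has no poles in the closed right half-plane. Consider a channel of $N\ge 1$ pools with transfer functions $G^{\rm in}_n,G^{\rm out}_n$ ($1\le n\le N$) from inflow and outflow to downstream water level. Each is proper with one integrator and no other unstable poles: for some storage capacity $c_n>0$, both $G^{\rm in}_n(s)-\frac{1}{c_n s}$ and $G^{\rm out}_n(s)+\frac1{c_n s}$ are stable. With gate flows $u_1,\dots,u_{N-1}$, disturbances $d_0$ (top inflow), $d_1,\dots,d_N$ (off-takes), $d_{N+1}$ (bottom outflow), and $y_n$ the level deviation in pool $n+1$ minus that in pool $n$, one has $\hat y=G\hat u+G^d\hat d$, where $G$ is the $(N-1)\times(N-1)$ matrix with $$G_{n,n}=G^{\rm in}_{n+1}-G^{\rm out}_n,\quad G_{n,n+1}=G^{\rm out}_{n+1},\quad G_{n,n-1}=-G^{\rm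 in}_n,$$ and $G^d$ is the $(N-1)\times(N+2)$ matrix with $$G^d_{1,1}=-G^{\rm in}_1,\quad G^d_{n,n+1}=-G^{\rm out}_n,\quad G^d_{n,n+2}=G^{\rm out}_{n+1},\quad G^d_{N-1,N+2}=G^{\rm out}_N,$$ all other entries being zero. Let $\nu=(\nu_1,\dots,\nu_{N-1})$ be a permutation of $\{1,\dots,N-1\}$ (the design order). Given compensators $C_{\nu_1},\dots,C_{\nu_{m-1}}$, put $\underline\nu=(\nu_1,\dots,\nu_{m-1})$ and $C_{\underline\nu}=\operatorname{diag}(C_{\nu_1},\dots,C_{\nu_{m-1}})$, let $\tilde G^{[m]}$ be $G$ with the columns in $\underline\nu$ replaced by zero, and let $G^{[m]}$ be the $(\nu_m,\nu_m)$ entry of $$H^{[m]}=\tilde G^{[m]}+G_{\bullet,\underline\nu}\,C_{\underline\nu}\,\bigl(I-G_{\underline\nu,\underline\nu}C_{\underline\nu}\bigr)^{-1}\tilde G^{[m]}_{\underline\nu,\bullet},$$ i.e. the transfer function from $\hat u_{\nu_m}$ to $\hat y_{\nu_m}$ with the loops $\hat u_{\nu_p}=C_{\nu_p}\hat y_{\nu_p}$,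 $p<m$, closed. Compensators are of the form $$C(s)=-K^p\Bigl(1+\frac{1}{T^I s}\Bigr)\frac{1}{1+T^F s},\qquad K^p,T^I,T^F>0. \tag{1}$$ $C$ *stabilizes* $P$ if $1-PC$ has no zeros in $\{\operatorname{Re}s\ge0,\ s\ne0\}$ and $(1-PC)^{-1}$, $P(1-PC)^{-1}$, $C(1-PC)^{-1}$ are stable. The loop has *phase margin* $\phi$ degrees if there is exactly one $\omega_c>0$ with $|P(i\omega_c)C(i\omega_c)|=1$, and $-P(i\omega_c)C(i\omega_c)$ has phase $-180+\phi$ degrees. **Theorem.** Let $\nu$ be any design order and $\phi_{\rm PM}\in(0,90)$. (a) For every step $m\in\{1,\dots,N-1\}$, and whatever compensators $C_{\nu_1},\dots,C_{\nu_{m-1}}$ of the form (1) were chosen before such that $C_{\nu_p}$ stabilizes $G^{[p]}$ for all $p<m$, there is a compensator $C_{\nu_m}$ of the form (1) that stabilizes $G^{[m]}$ with phase margin $\phi_{\rm PM}$ degrees. (b) Whenever $C_1,\dots,C_{N-1}$ are of the form (1) and $C_{\nu_m}$ stabilizes $G^{[m]}$ for every $m$, then, with $C=\operatorname{diag}(C_1,\dots,C_{N-1})$,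 the matrix $I-G(s)C(s)$ is invertible for $\operatorname{Re}s\ge0$, $s\neq0$, and every entry of the MIMO closed loop $(I-GC)^{-1}G^d$ is stable. Moreover, for every constant disturbance $d\in\mathbb R^{N+2}$ switched on at $t=0$, the output $y$, i.e. the unique right-continuous function on $[0,\infty)$ with Laplace transform $\hat y(s)=(I-G(s)C(s))^{-1}G^d(s)\,d/s$, exists and satisfies $$\lim_{t\to\infty}y(t)=\lim_{s\to0,\ \operatorname{Re}s>0}s\,\hat y(s)=0.$$ -/

import Mathlib

open MeasureTheory Filter Topology Set

noncomputable section

namespace Channel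

/-- Stable (possibly distributed-parameter) real transfer function: the impulse response is a real
signed Borel measure `μ₁ - μ₂` on `[0, ∞)` with `∫ exp (ε t) d(μ₁ + μ₂) < ∞` for some `ε > 0`, and
`F` is its Laplace transform on the closed right half-plane. Hence `F` continues analytically and
boundedly to `re s > -ε`: it is proper and has no poles in the closed right half-plane. The point
`s = 0`, where pointwise formulas such as `1 / s` take a junk value, is left out. -/
def Stable (F : ℂ → ℂ) : Prop :=
  ∃ (μ₁ μ₂ : Measure ℝ) (ε : ℝ), 0 < ε ∧ μ₁ (Iio 0) = 0 ∧ μ₂ (Iio 0) = 0 ∧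
    Integrable (fun t : ℝ => Real.exp (ε * t)) μ₁ ∧
    Integrable (fun t : ℝ => Real.exp (ε * t)) μ₂ ∧
    ∀ s : ℂ, 0 ≤ s.re → s ≠ 0 →
      F s = (∫ t : ℝ, Complex.exp (-s * (t : ℂ)) ∂μ₁) - ∫ t : ℝ, Complex.exp (-s * (t : ℂ)) ∂μ₂

/-- `F` is proper and, apart from an integrator with gain `g` (a pole at `s = 0` that is at most
simple, with residue `g`), has no poles in the closed right half-plane. -/
def HasIntegrator (F : ℂ → ℂ) (g : ℝ) : Prop :=
  Stable (fun s => F s - (g : ℂ) / s)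

/-- Transfer matrix from the `n` gate flows to the `n` level-error differences, for `n + 1` pools.
Gate `i` lies between pool `i.castSucc` (upstream) and pool `i.succ` (downstream). -/
def plant {n : ℕ} (Gin Gout : Fin (n + 1) → ℂ → ℂ) (s : ℂ) : Matrix (Fin n) (Fin n) ℂ :=
  Matrix.of fun i j =>
    if j = i then Gin i.succ s - Gout i.castSucc s
    else if (j : ℕ) = i + 1 then Gout i.succ s
    else if (i : ℕ) = j + 1 then -Gin i.castSucc s
    else 0

/-- Transfer matrix from the disturbances `d 0` (inflow at the top), `d 1, …, d (n + 1)` (off-takes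
of the `n + 1` pools) and `d (n + 2)` (outflow at the bottom) to the outputs. -/
def disturbancePlant {n : ℕ} (Gin Gout : Fin (n + 1) → ℂ → ℂ) (s : ℂ) :
    Matrix (Fin n) (Fin (n + 3)) ℂ :=
  Matrix.of fun i l =>
    if (i : ℕ) = 0 ∧ (l : ℕ) = 0 then -Gin i.castSucc s
    else if (l : ℕ) = i + 1 then -Gout i.castSucc s
    else if (l : ℕ) = i + 2 then Gout i.succ s
    else if (i : ℕ) + 1 = n ∧ (l : ℕ) = n + 2 then Gout i.succ s
    else 0

/-- PI compensator with low-pass filter. -/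
def IsPI (C : ℂ → ℂ) : Prop :=
  ∃ Kp TI TF : ℝ, 0 < Kp ∧ 0 < TI ∧ 0 < TF ∧
    ∀ s : ℂ, C s = -(Kp : ℂ) * (1 + 1 / ((TI : ℂ) * s)) * (1 / (1 + (TF : ℂ) * s))

/-- The transfer matrix with the columns of the loops closed before step `m` set to zero. -/
def maskedPlant {n : ℕ} (Gin Gout : Fin (n + 1) → ℂ → ℂ) (ν : Equiv.Perm (Fin n)) (m : Fin n)
    (s : ℂ) : Matrix (Fin n) (Fin n) ℂ :=
  Matrix.of fun k l => if ν.symm l < m then 0 else plant Gin Gout s k l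

/-- Transfer matrix from gate flows to outputs at step `m`, with the loops
`u (ν p) = C (ν p) * y (ν p)`, `p < m`, closed. -/
def partialPlant {n : ℕ} (Gin Gout : Fin (n + 1) → ℂ → ℂ) (ν : Equiv.Perm (Fin n))
    (C : Fin n → ℂ → ℂ) (m : Fin n) (s : ℂ) : Matrix (Fin n) (Fin n) ℂ :=
  let ι : {p : Fin n // p < m} → Fin n := fun p => ν p
  let G := plant Gin Gout s
  let Gt := maskedPlant Gin Gout ν m s
  let D : Matrix {p : Fin n // p < m} {p : Fin n // p < m} ℂ := Matrix.diagonal fun p => C (ι p) s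
  Gt + G.submatrix id ι * D * (1 - G.submatrix ι ι * D)⁻¹ * Gt.submatrix ι id

/-- The SISO plant from `u (ν m)` to `y (ν m)` seen at step `m`. -/
def stepPlant {n : ℕ} (Gin Gout : Fin (n + 1) → ℂ → ℂ) (ν : Equiv.Perm (Fin n))
    (C : Fin n → ℂ → ℂ) (m : Fin n) (s : ℂ) : ℂ :=
  partialPlant Gin Gout ν C m s (ν m) (ν m)

/-- Closed-loop stability of the SISO positive feedback loop `y = P (u + v)`, `u = C (y + w)`: the
loop is well posed, and the sensitivity `(1 - P C)⁻¹`, `P (1 - P C)⁻¹`, `C (1 - P C)⁻¹` (hence also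
`P C (1 - P C)⁻¹`) are stable. -/
def ClosedLoopStable (P C : ℂ → ℂ) : Prop :=
  (∀ s : ℂ, 0 ≤ s.re → s ≠ 0 → 1 - P s * C s ≠ 0) ∧
  Stable (fun s => (1 - P s * C s)⁻¹) ∧
  Stable (fun s => P s * (1 - P s * C s)⁻¹) ∧
  Stable (fun s => C s * (1 - P s * C s)⁻¹)

/-- The loop has exactly one crossover frequency `ωc > 0`, and there the phase of `-P C` is
`-180 + φ` degrees. -/
def HasPhaseMargin (P C : ℂ → ℂ) (φ : ℝ) : Prop :=
  ∃ ωc : ℝ, 0 < ωc ∧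
    (∀ ω : ℝ, 0 < ω →
      (‖P (Complex.I * (ω : ℂ)) * C (Complex.I * (ω : ℂ))‖ = 1 ↔ ω = ωc)) ∧
    -(P (Complex.I * (ωc : ℂ)) * C (Complex.I * (ωc : ℂ))) =
      Complex.exp ((((-180 + φ) * (Real.pi / 180) : ℝ) : ℂ) * Complex.I)

/-- The loop matrix `I - G C` with `C` diagonal. -/
def loopMatrix {n : ℕ} (Gin Gout : Fin (n + 1) → ℂ → ℂ) (C : Fin n → ℂ → ℂ) (s : ℂ) :
    Matrix (Fin n) (Fin n) ℂ :=
  1 - plant Gin Gout s * Matrix.diagonal fun i => C i s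

/-- The MIMO closed loop `(I - G C)⁻¹ Gᵈ` from disturbances to outputs. -/
def closedLoop {n : ℕ} (Gin Gout : Fin (n + 1) → ℂ → ℂ) (C : Fin n → ℂ → ℂ) (s : ℂ) :
    Matrix (Fin n) (Fin (n + 3)) ℂ :=
  (loopMatrix Gin Gout C s)⁻¹ * disturbancePlant Gin Gout s

/-- Laplace transform of the output under the constant disturbances `d`, switched on at `t = 0`. -/
def outputHat {n : ℕ} (Gin Gout : Fin (n + 1) → ℂ → ℂ) (C : Fin n → ℂ → ℂ) (d : Fin (n + 3) → ℝ)
    (s : ℂ) : Fin n → ℂ :=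
  (closedLoop Gin Gout C s).mulVec fun l => (d l : ℂ) / s

/-- `y`, on `t ≥ 0`, is the time-domain output with Laplace transform `yhat` (on some right
half-plane). A Laplace transform fixes a function only up to null sets; right-continuity selects
the step response itself. -/
def IsTimeOutput {n : ℕ} (yhat : ℂ → Fin n → ℂ) (y : ℝ → Fin n → ℝ) : Prop :=
  (∀ t : ℝ, 0 ≤ t → ContinuousWithinAt y (Ici t) t) ∧
  ∃ σ : ℝ, 0 ≤ σ ∧ ∀ s : ℂ, σ < s.re → ∀ k : Fin n,
    IntegrableOn (fun t : ℝ => Complex.exp (-s * (t : ℂ)) * (y t k : ℂ)) (Ioi 0) ∧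
    ∫ t in Ioi (0 : ℝ), Complex.exp (-s * (t : ℂ)) * (y t k : ℂ) = yhat s k

end Channel

end

/-!
The residue of the plant at the origin is a weighted Laplacian of the channel, `Bᵀ diag(1 / c) B`
with `B` the incidence matrix, hence positive definite. Closing one loop is a rank-one update: it
makes the row of that loop reject constant inputs and replaces the matrix of residues by a Schur
complement. The residues of the loops still open thus keep a positive definite quadratic form, so
the next single-loop plant again has one integrator, with positive gain.

Such a plant is stabilized by slow PI control. In the time scale `1 / k` the characteristic function
of the loop is a small perturbation, in the Banach algebra of stable transfer functions, of
`s² + g b s + g a`. Solving for the PI gains that put the crossover exactly at `ω = k` with the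
prescribed phase keeps `a` and `b` near positive limits as `k → 0`, and the crossover is unique
because the loop gain decreases near `ω = 0` and is below `1` elsewhere.

The step response of a stable transfer function `F` is the distribution function of its impulse
response, so it tends to the total mass `F 0`, which vanishes when `F s / s` is stable.
-/

noncomputable section

namespace Channel

open scoped ENNReal NNReal ComplexConjugate

/-! ### Stable transfer functions -/

/-- The mass of a measure for the exponential weight `exp (ε t)`. -/
def weightedMass (ε : ℝ) (μ : Measure ℝ) : ℝ≥0∞ :=
  ∫⁻ t, ENNReal.ofReal (Real.exp (ε * t)) ∂μ

/-- Laplace transform of a measure. -/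
def laplace (μ : Measure ℝ) (s : ℂ) : ℂ :=
  ∫ t : ℝ, Complex.exp (-s * (t : ℂ)) ∂μ

/-- The positive and negative parts of stable impulse responses: measures on `[0, ∞)` of finite
mass for the weight `exp (ε t)`. -/
structure IsCausalDecaying (ε : ℝ) (μ : Measure ℝ) : Prop where
  Iio_zero : μ (Iio 0) = 0
  weightedMass_ne_top : weightedMass ε μ ≠ ∞

section WeightedMass

variable {ε δ : ℝ} {μ ν : Measure ℝ}

theorem measurable_ofReal_exp_mul (ε : ℝ) :
    Measurable fun t : ℝ => ENNReal.ofReal (Real.exp (ε * t)) := by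
  fun_prop

theorem ae_nonneg_iff : (∀ᵐ t ∂μ, 0 ≤ t) ↔ μ (Iio 0) = 0 := by
  simp only [ae_iff, not_le]
  rfl

theorem integrable_exp_mul_iff :
    Integrable (fun t : ℝ => Real.exp (ε * t)) μ ↔ weightedMass ε μ ≠ ∞ := by
  rw [← lt_top_iff_ne_top, Integrable, and_iff_right (by fun_prop),
    hasFiniteIntegral_iff_ofReal (Eventually.of_forall fun t => (Real.exp_pos _).le)]
  rfl

theorem integral_exp_mul : ∫ t, Real.exp (ε * t) ∂μ = (weightedMass ε μ).toReal :=
  integral_eq_lintegral_of_nonneg_ae (Eventually.of_forall fun _ => (Real.exp_pos _).le)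
    (by fun_prop)

theorem weightedMass_zero : weightedMass 0 μ = μ univ := by
  simp [weightedMass]

theorem weightedMass_mono (h : δ ≤ ε) (h0 : μ (Iio 0) = 0) :
    weightedMass δ μ ≤ weightedMass ε μ := by
  refine lintegral_mono_ae ?_
  filter_upwards [ae_nonneg_iff.2 h0] with t ht
  gcongr

theorem weightedMass_add : weightedMass ε (μ + ν) = weightedMass ε μ + weightedMass ε ν :=
  lintegral_add_measure _ _ _

theorem weightedMass_sum {ι : Type*} (μ : ι → Measure ℝ) :
    weightedMass ε (Measure.sum μ) = ∑' i, weightedMass ε (μ i) :=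
  lintegral_sum_measure _ _

theorem weightedMass_smul_dirac_zero (c : ℝ≥0∞) :
    weightedMass ε (c • Measure.dirac 0) = c := by
  simp [weightedMass]

theorem weightedMass_conv [SFinite ν] :
    weightedMass ε (μ.conv ν) = weightedMass ε μ * weightedMass ε ν := by
  rw [weightedMass, Measure.lintegral_conv (measurable_ofReal_exp_mul ε)]
  simp_rw [mul_add, Real.exp_add, ENNReal.ofReal_mul (Real.exp_pos _).le,
    lintegral_const_mul _ (measurable_ofReal_exp_mul ε)]
  exact lintegral_mul_const _ (measurable_ofReal_exp_mul ε)

theorem weightedMass_map_mul (k : ℝ) :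
    weightedMass ε (μ.map fun t => k * t) = weightedMass (ε * k) μ := by
  rw [weightedMass, lintegral_map (measurable_ofReal_exp_mul ε) (by fun_prop)]
  simp_rw [← mul_assoc]
  rfl

theorem conv_Iio_zero [SFinite μ] [SFinite ν] (hμ : μ (Iio 0) = 0) (hν : ν (Iio 0) = 0) :
    (μ.conv ν) (Iio 0) = 0 := by
  rw [← ae_nonneg_iff, Measure.conv, ae_map_iff (by fun_prop) measurableSet_Ici]
  filter_upwards [Measure.quasiMeasurePreserving_fst.ae (ae_nonneg_iff.2 hμ),
    Measure.quasiMeasurePreserving_snd.ae (ae_nonneg_iff.2 hν)] with x hx hy using add_nonneg hx hy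

theorem laplace_conv [SFinite μ] [SFinite ν] (s : ℂ) :
    laplace (μ.conv ν) s = laplace μ s * laplace ν s := by
  rw [laplace, Measure.conv, integral_map (by fun_prop) (by fun_prop), laplace, laplace,
    ← integral_prod_mul]
  congr 1
  ext x
  rw [← Complex.exp_add]
  congr 1
  push_cast
  ring

theorem laplace_map_mul (k : ℝ) (s : ℂ) :
    laplace (μ.map fun t => k * t) s = laplace μ (k * s) := by
  rw [laplace, integral_map (by fun_prop) (by fun_prop), laplace]
  congr 1
  ext t
  congr 1
  push_cast
  ring

theorem norm_exp_neg_mul_le (hε : 0 ≤ ε) {s : ℂ} (hs : 0 ≤ s.re) {t : ℝ} (ht : 0 ≤ t) :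
    ‖Complex.exp (-s * (t : ℂ))‖ ≤ Real.exp (ε * t) := by
  rw [Complex.norm_exp, Complex.re_mul_ofReal, Complex.neg_re]
  gcongr
  linarith

namespace IsCausalDecaying

theorem ae_nonneg (hμ : IsCausalDecaying ε μ) : ∀ᵐ t ∂μ, 0 ≤ t :=
  ae_nonneg_iff.2 hμ.Iio_zero

theorem mono (hμ : IsCausalDecaying ε μ) (h : δ ≤ ε) : IsCausalDecaying δ μ :=
  ⟨hμ.1, ne_top_of_le_ne_top hμ.2 (weightedMass_mono h hμ.1)⟩

theorem isFiniteMeasure (hε : 0 ≤ ε) (hμ : IsCausalDecaying ε μ) : IsFiniteMeasure μ :=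
  ⟨weightedMass_zero (μ := μ) ▸ (hμ.mono hε).2.lt_top⟩

theorem integrable_exp_neg_mul (hε : 0 ≤ ε) (hμ : IsCausalDecaying ε μ) {s : ℂ} (hs : 0 ≤ s.re) :
    Integrable (fun t : ℝ => Complex.exp (-s * (t : ℂ))) μ := by
  refine (integrable_exp_mul_iff.2 hμ.2).mono' (by fun_prop) ?_
  filter_upwards [hμ.ae_nonneg] with t ht using norm_exp_neg_mul_le hε hs ht

theorem norm_laplace_le (hε : 0 ≤ ε) (hμ : IsCausalDecaying ε μ) {s : ℂ} (hs : 0 ≤ s.re) :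
    ‖laplace μ s‖ ≤ (weightedMass ε μ).toReal := by
  rw [← integral_exp_mul]
  refine norm_integral_le_of_norm_le (integrable_exp_mul_iff.2 hμ.2) ?_
  filter_upwards [hμ.ae_nonneg] with t ht using norm_exp_neg_mul_le hε hs ht

theorem add (hμ : IsCausalDecaying ε μ) (hν : IsCausalDecaying ε ν) :
    IsCausalDecaying ε (μ + ν) :=
  ⟨by simp [hμ.1, hν.1], by simp [weightedMass_add, hμ.2, hν.2]⟩

theorem conv (hε : 0 ≤ ε) (hμ : IsCausalDecaying ε μ) (hν : IsCausalDecaying ε ν) :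
    IsCausalDecaying ε (μ.conv ν) := by
  have := hμ.isFiniteMeasure hε
  have := hν.isFiniteMeasure hε
  exact ⟨conv_Iio_zero hμ.1 hν.1, weightedMass_conv.trans_ne (ENNReal.mul_ne_top hμ.2 hν.2)⟩

theorem laplace_add (hε : 0 ≤ ε) (hμ : IsCausalDecaying ε μ) (hν : IsCausalDecaying ε ν) {s : ℂ}
    (hs : 0 ≤ s.re) : laplace (μ + ν) s = laplace μ s + laplace ν s :=
  integral_add_measure (hμ.integrable_exp_neg_mul hε hs) (hν.integrable_exp_neg_mul hε hs)

theorem hasSum_laplace (hε : 0 ≤ ε) {ι : Type*} {μ : ι → Measure ℝ}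
    (hμ : IsCausalDecaying ε (Measure.sum μ)) {s : ℂ} (hs : 0 ≤ s.re) :
    HasSum (fun i => laplace (μ i) s) (laplace (Measure.sum μ) s) :=
  hasSum_integral_measure (hμ.integrable_exp_neg_mul hε hs)

end IsCausalDecaying

end WeightedMass

/-- Quantitative stability: the impulse response is `μ₁ - μ₂` with total mass at most `M` for the
weight `exp (ε t)`. -/
def StableWith (ε : ℝ) (M : ℝ≥0) (F : ℂ → ℂ) : Prop :=
  ∃ μ₁ μ₂ : Measure ℝ, IsCausalDecaying ε μ₁ ∧ IsCausalDecaying ε μ₂ ∧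
    weightedMass ε μ₁ + weightedMass ε μ₂ ≤ M ∧
    ∀ s : ℂ, 0 ≤ s.re → s ≠ 0 → F s = laplace μ₁ s - laplace μ₂ s

namespace StableWith

variable {ε δ : ℝ} {M N : ℝ≥0} {F G : ℂ → ℂ}

theorem of_weightedMass_add_le {μ₁ μ₂ : Measure ℝ} (h₁ : μ₁ (Iio 0) = 0) (h₂ : μ₂ (Iio 0) = 0)
    (hM : weightedMass ε μ₁ + weightedMass ε μ₂ ≤ M)
    (hF : IsCausalDecaying ε μ₁ → IsCausalDecaying ε μ₂ → ∀ s : ℂ, 0 ≤ s.re → s ≠ 0 →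
      F s = laplace μ₁ s - laplace μ₂ s) : StableWith ε M F := by
  obtain ⟨f₁, f₂⟩ := ENNReal.add_ne_top.1 (hM.trans_lt ENNReal.coe_lt_top).ne
  exact ⟨μ₁, μ₂, ⟨h₁, f₁⟩, ⟨h₂, f₂⟩, hM, hF ⟨h₁, f₁⟩ ⟨h₂, f₂⟩⟩

theorem stable (hε : 0 < ε) (h : StableWith ε M F) : Stable F := by
  obtain ⟨μ₁, μ₂, h₁, h₂, -, hF⟩ := h
  exact ⟨μ₁, μ₂, ε, hε, h₁.1, h₂.1, integrable_exp_mul_iff.2 h₁.2, integrable_exp_mul_iff.2 h₂.2,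
    hF⟩

theorem congr (h : StableWith ε M F) (hFG : ∀ s : ℂ, 0 ≤ s.re → s ≠ 0 → G s = F s) :
    StableWith ε M G := by
  obtain ⟨μ₁, μ₂, h₁, h₂, hM, hF⟩ := h
  exact ⟨μ₁, μ₂, h₁, h₂, hM, fun s hs h0 => (hFG s hs h0).trans (hF s hs h0)⟩

theorem mono (h : StableWith ε M F) (hδ : δ ≤ ε) : StableWith δ M F := by
  obtain ⟨μ₁, μ₂, h₁, h₂, hM, hF⟩ := h
  exact ⟨μ₁, μ₂, h₁.mono hδ, h₂.mono hδ,
    (add_le_add (weightedMass_mono hδ h₁.1) (weightedMass_mono hδ h₂.1)).trans hM, hF⟩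

theorem norm_le (hε : 0 ≤ ε) (h : StableWith ε M F) {s : ℂ} (hs : 0 ≤ s.re) (h0 : s ≠ 0) :
    ‖F s‖ ≤ M := by
  obtain ⟨μ₁, μ₂, h₁, h₂, hM, hF⟩ := h
  calc ‖F s‖ = ‖laplace μ₁ s - laplace μ₂ s‖ := by rw [hF s hs h0]
    _ ≤ (weightedMass ε μ₁).toReal + (weightedMass ε μ₂).toReal :=
        norm_sub_le_of_le (h₁.norm_laplace_le hε hs) (h₂.norm_laplace_le hε hs)
    _ = (weightedMass ε μ₁ + weightedMass ε μ₂).toReal := (ENNReal.toReal_add h₁.2 h₂.2).symm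
    _ ≤ M := ENNReal.toReal_mono ENNReal.coe_ne_top hM

theorem add (hε : 0 ≤ ε) (hF : StableWith ε M F) (hG : StableWith ε N G) :
    StableWith ε (M + N) (fun s => F s + G s) := by
  obtain ⟨μ₁, μ₂, h₁, h₂, hM, hF⟩ := hF
  obtain ⟨ν₁, ν₂, k₁, k₂, hN, hG⟩ := hG
  refine ⟨μ₁ + ν₁, μ₂ + ν₂, h₁.add k₁, h₂.add k₂, ?_, fun s hs h0 => ?_⟩
  · rw [weightedMass_add, weightedMass_add, add_add_add_comm, ENNReal.coe_add]
    exact add_le_add hM hN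
  · beta_reduce
    rw [h₁.laplace_add hε k₁ hs, h₂.laplace_add hε k₂ hs, hF s hs h0, hG s hs h0]
    ring

theorem mul (hε : 0 ≤ ε) (hF : StableWith ε M F) (hG : StableWith ε N G) :
    StableWith ε (M * N) (fun s => F s * G s) := by
  obtain ⟨μ₁, μ₂, h₁, h₂, hM, hF⟩ := hF
  obtain ⟨ν₁, ν₂, k₁, k₂, hN, hG⟩ := hG
  have := h₁.isFiniteMeasure hε
  have := h₂.isFiniteMeasure hε
  have := k₁.isFiniteMeasure hε
  have := k₂.isFiniteMeasure hε
  have h₁₁ := h₁.conv hε k₁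
  have h₂₂ := h₂.conv hε k₂
  have h₁₂ := h₁.conv hε k₂
  have h₂₁ := h₂.conv hε k₁
  refine ⟨μ₁.conv ν₁ + μ₂.conv ν₂, μ₁.conv ν₂ + μ₂.conv ν₁, h₁₁.add h₂₂, h₁₂.add h₂₁, ?_,
    fun s hs h0 => ?_⟩
  · simp only [weightedMass_add, weightedMass_conv, ENNReal.coe_mul]
    refine le_trans (le_of_eq ?_) (mul_le_mul' hM hN)
    ring
  · rw [h₁₁.laplace_add hε h₂₂ hs, h₁₂.laplace_add hε h₂₁ hs]
    simp only [laplace_conv, hF s hs h0, hG s hs h0]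
    ring

theorem const (r : ℝ) : StableWith ε ‖r‖₊ (fun _ => (r : ℂ)) := by
  refine of_weightedMass_add_le (μ₁ := ENNReal.ofReal r • Measure.dirac 0)
    (μ₂ := ENNReal.ofReal (-r) • Measure.dirac 0) (by simp) (by simp) ?_ fun _ _ s _ _ => ?_
  · rw [weightedMass_smul_dirac_zero, weightedMass_smul_dirac_zero, ← enorm_eq_nnnorm,
      ← ofReal_norm]
    rcases le_total 0 r with h | h <;>
      simp [h, ENNReal.ofReal_of_nonpos, abs_of_nonneg, abs_of_nonpos]
  · simp [laplace, integral_smul_measure, ENNReal.toReal_ofReal', ← Complex.ofReal_sub,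
      max_zero_sub_max_neg_zero_eq_self]

theorem const_mul (hε : 0 ≤ ε) (r : ℝ) (hF : StableWith ε M F) :
    StableWith ε (‖r‖₊ * M) (fun s => r * F s) :=
  (const r).mul hε hF

theorem neg (hε : 0 ≤ ε) (hF : StableWith ε M F) : StableWith ε M (fun s => -F s) := by
  simpa using hF.const_mul hε (-1)

theorem pow (hε : 0 ≤ ε) (hF : StableWith ε M F) (n : ℕ) :
    StableWith ε (M ^ n) (fun s => F s ^ n) := by
  induction n with
  | zero => simpa using const (ε := ε) 1
  | succ n ih => simpa only [pow_succ] using ih.mul hε hF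

theorem comp_mul {k : ℝ} (hk : 0 < k) (hF : StableWith (ε * k) M F) :
    StableWith ε M (fun s => F (k * s)) := by
  obtain ⟨μ₁, μ₂, h₁, h₂, hM, hF⟩ := hF
  have map_Iio {μ : Measure ℝ} (hμ : μ (Iio 0) = 0) : (μ.map fun t => k * t) (Iio 0) = 0 := by
    rw [← ae_nonneg_iff, ae_map_iff (by fun_prop) measurableSet_Ici]
    filter_upwards [ae_nonneg_iff.2 hμ] with t ht using mul_nonneg hk.le ht
  refine of_weightedMass_add_le (map_Iio h₁.1) (map_Iio h₂.1) ?_ fun _ _ s hs h0 => ?_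
  · simpa only [weightedMass_map_mul] using hM
  · rw [laplace_map_mul, laplace_map_mul]
    exact hF _ (by simpa using mul_nonneg hk.le hs) (mul_ne_zero (by simpa using hk.ne') h0)

theorem one_add_ne_zero (hε : 0 ≤ ε) (hF : StableWith ε M F) (hM : M < 1)
    {s : ℂ} (hs : 0 ≤ s.re) (h0 : s ≠ 0) : 1 + F s ≠ 0 := by
  intro h
  have hle : ‖F s‖ ≤ M := hF.norm_le hε hs h0
  rw [eq_neg_of_add_eq_zero_right h, norm_neg, norm_one] at hle
  exact hM.not_ge (by exact_mod_cast hle)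

theorem sum_of_tsum_le {f : ℕ → ℂ → ℂ} {m : ℕ → ℝ≥0} (hε : 0 ≤ ε)
    (hf : ∀ n, StableWith ε (m n) (f n)) (hm : ∑' n, (m n : ℝ≥0∞) ≤ M)
    (hF : ∀ s : ℂ, 0 ≤ s.re → s ≠ 0 → HasSum (fun n => f n s) (F s)) : StableWith ε M F := by
  choose μ₁ μ₂ h₁ h₂ hb hs using hf
  refine of_weightedMass_add_le (μ₁ := Measure.sum μ₁) (μ₂ := Measure.sum μ₂) ?_ ?_ ?_
    fun k₁ k₂ s hs0 h0 => ?_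
  · simp [Measure.sum_apply _ measurableSet_Iio, (h₁ _).1]
  · simp [Measure.sum_apply _ measurableSet_Iio, (h₂ _).1]
  · rw [weightedMass_sum, weightedMass_sum, ← ENNReal.tsum_add]
    exact (ENNReal.tsum_le_tsum hb).trans hm
  · refine (hF s hs0 h0).unique ?_
    simpa only [hs _ s hs0 h0] using (k₁.hasSum_laplace hε hs0).sub (k₂.hasSum_laplace hε hs0)

theorem inv_one_add (hε : 0 ≤ ε) (hF : StableWith ε M F) (hM : M < 1) :
    StableWith ε (1 - M)⁻¹ (fun s => (1 + F s)⁻¹) := by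
  refine sum_of_tsum_le hε (fun n => (hF.neg hε).pow hε n) (le_of_eq ?_) fun s hs h0 => ?_
  · simp only [ENNReal.coe_pow, ENNReal.tsum_geometric,
      ENNReal.coe_inv (tsub_pos_of_lt hM).ne', ENNReal.coe_sub, ENNReal.coe_one]
  · have hlt : ‖-F s‖ < 1 := ((hF.neg hε).norm_le hε hs h0).trans_lt (by exact_mod_cast hM)
    simpa only [sub_neg_eq_add] using hasSum_geometric_of_norm_lt_one hlt

end StableWith

namespace Stable

variable {F G : ℂ → ℂ}

theorem congr (h : Stable F) (hFG : ∀ s : ℂ, 0 ≤ s.re → s ≠ 0 → G s = F s) : Stable G := by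
  obtain ⟨μ₁, μ₂, ε, hε, h₁, h₂, i₁, i₂, hF⟩ := h
  exact ⟨μ₁, μ₂, ε, hε, h₁, h₂, i₁, i₂, fun s hs h0 => (hFG s hs h0).trans (hF s hs h0)⟩

theorem exists_stableWith (h : Stable F) : ∃ ε > 0, ∃ M, StableWith ε M F := by
  obtain ⟨μ₁, μ₂, ε, hε, h₁, h₂, i₁, i₂, hF⟩ := h
  have d₁ : IsCausalDecaying ε μ₁ := ⟨h₁, integrable_exp_mul_iff.1 i₁⟩
  have d₂ : IsCausalDecaying ε μ₂ := ⟨h₂, integrable_exp_mul_iff.1 i₂⟩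
  refine ⟨ε, hε, (weightedMass ε μ₁ + weightedMass ε μ₂).toNNReal, μ₁, μ₂, d₁, d₂, ?_, hF⟩
  rw [ENNReal.coe_toNNReal (ENNReal.add_ne_top.2 ⟨d₁.2, d₂.2⟩)]

theorem eventually_stableWith (h : Stable F) : ∀ᶠ ε in 𝓝[>] (0 : ℝ), ∃ M, StableWith ε M F := by
  obtain ⟨ε, hε, M, h⟩ := h.exists_stableWith
  filter_upwards [Ioo_mem_nhdsGT hε] with δ hδ using ⟨M, h.mono hδ.2.le⟩

theorem exists_common_stableWith (hF : Stable F) (hG : Stable G) :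
    ∃ ε > 0, (∃ M, StableWith ε M F) ∧ ∃ N, StableWith ε N G :=
  (eventually_mem_nhdsWithin.and (hF.eventually_stableWith.and hG.eventually_stableWith)).exists

theorem add (hF : Stable F) (hG : Stable G) : Stable (fun s => F s + G s) := by
  obtain ⟨ε, hε, ⟨M, hF⟩, ⟨N, hG⟩⟩ := exists_common_stableWith hF hG
  exact (hF.add hε.le hG).stable hε

theorem mul (hF : Stable F) (hG : Stable G) : Stable (fun s => F s * G s) := by
  obtain ⟨ε, hε, ⟨M, hF⟩, ⟨N, hG⟩⟩ := exists_common_stableWith hF hG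
  exact (hF.mul hε.le hG).stable hε

theorem const (r : ℝ) : Stable (fun _ => (r : ℂ)) :=
  (StableWith.const (ε := 1) r).stable one_pos

theorem const_mul (r : ℝ) (hF : Stable F) : Stable (fun s => r * F s) :=
  (const r).mul hF

theorem neg (hF : Stable F) : Stable (fun s => -F s) := by
  simpa using hF.const_mul (-1)

theorem sub (hF : Stable F) (hG : Stable G) : Stable (fun s => F s - G s) := by
  simpa only [sub_eq_add_neg] using hF.add hG.neg

theorem sum {ι : Type*} (S : Finset ι) {F : ι → ℂ → ℂ} (h : ∀ i ∈ S, Stable (F i)) :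
    Stable (fun s => ∑ i ∈ S, F i s) := by
  classical
  induction S using Finset.induction_on with
  | empty => simpa using const 0
  | insert i S hi ih =>
    simp only [Finset.sum_insert hi]
    exact (h i (by simp)).add (ih fun j hj => h j (by simp [hj]))

theorem comp_mul {k : ℝ} (hk : 0 < k) (hF : Stable F) : Stable (fun s => F (k * s)) := by
  obtain ⟨ε, hε, M, h⟩ := hF.exists_stableWith
  refine StableWith.stable (ε := ε / k) (M := M) (by positivity) (StableWith.comp_mul hk ?_)
  rwa [div_mul_cancel₀ _ hk.ne']

theorem of_comp_mul {k : ℝ} (hk : 0 < k) (hF : Stable (fun s => F (k * s))) : Stable F := by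
  have hk' : (k : ℂ) ≠ 0 := by exact_mod_cast hk.ne'
  refine (hF.comp_mul (inv_pos.2 hk)).congr fun s _ _ => ?_
  rw [Complex.ofReal_inv, mul_inv_cancel_left₀ hk']

theorem exists_norm_le (hF : Stable F) :
    ∃ M : ℝ≥0, ∀ s : ℂ, 0 ≤ s.re → s ≠ 0 → ‖F s‖ ≤ M := by
  obtain ⟨ε, hε, M, h⟩ := hF.exists_stableWith
  exact ⟨M, fun s hs h0 => h.norm_le hε.le hs h0⟩

end Stable

section ImaginaryAxis

theorem norm_exp_sub_exp_imaginary_le {ε t : ℝ} (hε : 0 < ε) (ht : 0 ≤ t) (u v : ℝ) :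
    ‖Complex.exp (-(Complex.I * u) * t) - Complex.exp (-(Complex.I * v) * t)‖ ≤
      Real.exp (ε * t) * (|u - v| / ε) := by
  have factor : Complex.exp (-(Complex.I * u) * t) - Complex.exp (-(Complex.I * v) * t) =
      Complex.exp (-(Complex.I * v) * t) *
        (Complex.exp (Complex.I * ((-((u - v) * t) : ℝ) : ℂ)) - 1) := by
    rw [mul_sub, mul_one, ← Complex.exp_add]
    congr 2
    push_cast
    ring
  have unit : ‖Complex.exp (-(Complex.I * v) * t)‖ = 1 := by simp [Complex.norm_exp]
  calc _ ≤ ‖-((u - v) * t)‖ := by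
        rw [factor, norm_mul, unit, one_mul]
        exact Real.norm_exp_I_mul_ofReal_sub_one_le
    _ = ε * t * (|u - v| / ε) := by
        rw [norm_neg, norm_mul, Real.norm_of_nonneg ht, Real.norm_eq_abs]
        field_simp
    _ ≤ Real.exp (ε * t) * (|u - v| / ε) := by
        gcongr
        linarith [Real.add_one_le_exp (ε * t)]

theorem IsCausalDecaying.norm_laplace_sub_le {ε : ℝ} {μ : Measure ℝ} (hε : 0 < ε)
    (hμ : IsCausalDecaying ε μ) (u v : ℝ) :
    ‖laplace μ (Complex.I * u) - laplace μ (Complex.I * v)‖ ≤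
      (weightedMass ε μ).toReal * (|u - v| / ε) := by
  rw [← integral_exp_mul, laplace, laplace,
    ← integral_sub (hμ.integrable_exp_neg_mul hε.le (by simp))
      (hμ.integrable_exp_neg_mul hε.le (by simp)), ← integral_mul_const]
  refine norm_integral_le_of_norm_le ((integrable_exp_mul_iff.2 hμ.2).mul_const _) ?_
  filter_upwards [hμ.ae_nonneg] with t ht using norm_exp_sub_exp_imaginary_le hε ht u v

theorem Stable.exists_lipschitzOnWith {F : ℂ → ℂ} (hF : Stable F) :
    ∃ K, LipschitzOnWith K (fun ω : ℝ => F (Complex.I * ω)) (Ioi 0) := by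
  obtain ⟨ε, hε, M, μ₁, μ₂, h₁, h₂, -, hF⟩ := hF.exists_stableWith
  refine ⟨_, LipschitzOnWith.of_dist_le_mul (K := Real.toNNReal
    (((weightedMass ε μ₁).toReal + (weightedMass ε μ₂).toReal) / ε)) fun u hu v hv => ?_⟩
  have hne {w : ℝ} (hw : w ∈ Ioi 0) : Complex.I * (w : ℂ) ≠ 0 := by simp [(mem_Ioi.1 hw).ne']
  rw [Real.coe_toNNReal _ (by positivity), dist_eq_norm, hF _ (by simp) (hne hu),
    hF _ (by simp) (hne hv), sub_sub_sub_comm, Real.dist_eq, div_mul_eq_mul_div, mul_div_assoc,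
    add_mul]
  exact norm_sub_le_of_le (h₁.norm_laplace_sub_le hε u v) (h₂.norm_laplace_sub_le hε u v)

end ImaginaryAxis

/-! ### Rational transfer functions -/

section Density

variable {α E : Type*} [MeasurableSpace α] [NormedAddCommGroup E] [NormedSpace ℝ E]
  {μ : Measure α} {f : α → ℝ} {φ : α → E}

theorem integrable_max_zero_smul (hf : AEMeasurable f μ) (hφ : AEStronglyMeasurable φ μ)
    (h : Integrable (fun x => f x • φ x) μ) : Integrable (fun x => max (f x) 0 • φ x) μ := by
  refine h.mono ((hf.max aemeasurable_const).aestronglyMeasurable.smul hφ)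
    (Eventually.of_forall fun x => ?_)
  rw [norm_smul, norm_smul]
  gcongr
  rw [Real.norm_eq_abs, Real.norm_eq_abs, abs_of_nonneg (le_max_right _ _)]
  exact max_le (le_abs_self _) (abs_nonneg _)

theorem integrable_withDensity_ofReal (hf : AEMeasurable f μ) (hφ : AEStronglyMeasurable φ μ)
    (h : Integrable (fun x => f x • φ x) μ) :
    Integrable φ (μ.withDensity fun x => ENNReal.ofReal (f x)) := by
  rw [integrable_withDensity_iff_integrable_smul₀' (by fun_prop) (by simp)]
  simpa only [ENNReal.toReal_ofReal'] using integrable_max_zero_smul hf hφ h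

theorem integral_withDensity_ofReal_sub (hf : AEMeasurable f μ) (hφ : AEStronglyMeasurable φ μ)
    (h : Integrable (fun x => f x • φ x) μ) :
    (∫ x, φ x ∂μ.withDensity fun x => ENNReal.ofReal (f x)) -
      ∫ x, φ x ∂μ.withDensity (fun x => ENNReal.ofReal (-f x)) = ∫ x, f x • φ x ∂μ := by
  have hpos := integrable_max_zero_smul hf hφ h
  have hneg : Integrable (fun x => max (-f x) 0 • φ x) μ :=
    integrable_max_zero_smul hf.neg hφ (h.neg.congr (Eventually.of_forall fun x => by simp))
  rw [integral_withDensity_eq_integral_toReal_smul₀ (by fun_prop) (by simp),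
    integral_withDensity_eq_integral_toReal_smul₀ (by fun_prop) (by simp)]
  simp only [ENNReal.toReal_ofReal']
  rw [← integral_sub hpos hneg]
  simp only [← sub_smul, max_zero_sub_max_neg_zero_eq_self]

end Density

section RationalFunctions

theorem IsCausalDecaying.withDensity_ofReal {ε : ℝ} {f : ℝ → ℝ} (hf : Measurable f)
    (h : IntegrableOn (fun t => f t • Real.exp (ε * t)) (Ioi 0)) :
    IsCausalDecaying ε ((volume.restrict (Ioi 0)).withDensity fun t => ENNReal.ofReal (f t)) where
  Iio_zero := by
    refine withDensity_absolutelyContinuous _ _ ?_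
    rw [Measure.restrict_apply measurableSet_Iio, Iio_inter_Ioi, Ioo_self, measure_empty]
  weightedMass_ne_top :=
    integrable_exp_mul_iff.1 (integrable_withDensity_ofReal hf.aemeasurable (by fun_prop) h)

theorem stable_of_density {ε : ℝ} {f : ℝ → ℝ} (hε : 0 < ε) (hf : Measurable f)
    (h : IntegrableOn (fun t => f t • Real.exp (ε * t)) (Ioi 0)) :
    Stable (fun s => ∫ t in Ioi (0 : ℝ), f t • Complex.exp (-s * (t : ℂ))) := by
  have hpos : IsCausalDecaying ε _ := .withDensity_ofReal hf h
  have hneg : IsCausalDecaying ε _ := .withDensity_ofReal hf.neg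
    (h.neg.congr (Eventually.of_forall fun t => by simp))
  refine ⟨_, _, ε, hε, hpos.1, hneg.1, integrable_exp_mul_iff.2 hpos.2,
    integrable_exp_mul_iff.2 hneg.2, fun s hs _ => ?_⟩
  suffices hint : IntegrableOn (fun t => f t • Complex.exp (-s * (t : ℂ))) (Ioi 0) from
    (integral_withDensity_ofReal_sub hf.aemeasurable (by fun_prop) hint).symm
  refine Integrable.mono h (hf.aestronglyMeasurable.smul (by fun_prop)) ?_
  filter_upwards [ae_restrict_mem measurableSet_Ioi] with t ht
  rw [norm_smul, norm_smul, Real.norm_of_nonneg (Real.exp_pos _).le]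
  gcongr
  exact norm_exp_neg_mul_le hε.le hs (mem_Ioi.1 ht).le

theorem stable_conjugate_poles {z : ℂ} (hz : z.re < 0) (c : ℂ) :
    Stable (fun s => c * (s - z)⁻¹ + conj c * (s - conj z)⁻¹) := by
  have hint : ∀ w : ℂ, w.re < 0 → ∀ a : ℂ, IntegrableOn (fun t : ℝ => a * Complex.exp (w * t))
      (Ioi 0) := fun w hw a => (integrableOn_exp_mul_complex_Ioi hw 0).const_mul a
  have hval : ∀ w : ℂ, w.re < 0 → ∫ t : ℝ in Ioi 0, Complex.exp (w * t) = (-w)⁻¹ :=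
    fun w hw => by simp [integral_exp_mul_complex_Ioi hw, neg_div, inv_neg]
  have key := stable_of_density (ε := -z.re / 2) (by linarith)
    (f := fun t => 2 * (c * Complex.exp (z * t)).re) (by fun_prop) ?_
  · refine key.congr fun s hs _ => ?_
    have h₁ : (z - s).re < 0 := by rw [Complex.sub_re]; linarith
    have h₂ : (conj z - s).re < 0 := by rw [Complex.sub_re, Complex.conj_re]; linarith
    rw [← neg_sub z s, ← neg_sub (conj z) s, ← hval _ h₁, ← hval _ h₂, ← integral_const_mul,
      ← integral_const_mul, ← integral_add (hint _ h₁ c) (hint _ h₂ _)]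
    refine integral_congr_ae (Eventually.of_forall fun t => ?_)
    have hre : ((2 * (c * Complex.exp (z * t)).re : ℝ) : ℂ) =
        c * Complex.exp (z * t) + conj c * Complex.exp (conj z * t) := by
      rw [← Complex.add_conj, map_mul, ← Complex.exp_conj,
        map_mul, Complex.conj_ofReal]
    simp only [Complex.real_smul, hre, sub_eq_add_neg, add_mul, Complex.exp_add]
    ring
  · refine (hint (z + ((-z.re / 2 : ℝ) : ℂ)) ?_ (2 * c)).re.congr
      (Eventually.of_forall fun t => ?_)
    · rw [Complex.add_re, Complex.ofReal_re]
      linarith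
    · simp only [RCLike.re_to_complex, add_mul, Complex.exp_add, ← Complex.ofReal_mul,
        ← Complex.ofReal_exp, ← mul_assoc, Complex.re_mul_ofReal, smul_eq_mul]
      rw [mul_assoc 2 c, ← Complex.ofReal_ofNat, Complex.re_ofReal_mul]

theorem add_ofReal_ne_zero {p : ℝ} (hp : 0 < p) {s : ℂ} (hs : 0 ≤ s.re) : s + p ≠ 0 := fun h => by
  have := congrArg Complex.re h
  simp only [Complex.add_re, Complex.ofReal_re, Complex.zero_re] at this
  linarith

theorem stable_inv_add {p : ℝ} (hp : 0 < p) : Stable (fun s => (s + p)⁻¹) := by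
  refine (stable_conjugate_poles (z := (-p : ℝ)) (by simpa) ((1 / 2 : ℝ) : ℂ)).congr
    fun s _ _ => ?_
  simp only [Complex.conj_ofReal]
  push_cast
  ring

theorem stable_linear_div_linear {p : ℝ} (hp : 0 < p) (α β : ℝ) :
    Stable (fun s => (α * s + β) / (s + p)) := by
  refine ((Stable.const α).add ((stable_inv_add hp).const_mul (β - α * p))).congr fun s hs _ => ?_
  have hne := add_ofReal_ne_zero hp hs
  field_simp
  push_cast
  ring

theorem quadratic_ne_zero {a b : ℝ} (ha : 0 < a) (hb : 0 < b) {s : ℂ} (hs : 0 ≤ s.re) :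
    s ^ 2 + b * s + a ≠ 0 := by
  intro h
  have him : s.im * (2 * s.re + b) = 0 := by
    have := congrArg Complex.im h
    simp only [pow_two, Complex.add_im, Complex.mul_im, Complex.ofReal_re, Complex.ofReal_im,
      Complex.zero_im] at this
    linarith
  have hre := congrArg Complex.re h
  rcases mul_eq_zero.1 him with h0 | h0
  · simp only [pow_two, Complex.add_re, Complex.mul_re, Complex.ofReal_re, Complex.ofReal_im, h0,
      Complex.zero_re] at hre
    nlinarith
  · linarith

theorem stable_linear_div_of_im_ne_zero {z : ℂ} (hz : z.re < 0) (him : z.im ≠ 0) (α β : ℝ) :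
    Stable (fun s => (α * s + β) / ((s - z) * (s - conj z))) := by
  have hne : z - conj z ≠ 0 := by simpa [Complex.sub_conj] using him
  refine (stable_conjugate_poles hz ((α * z + β) / (z - conj z))).congr fun s hs _ => ?_
  have h₁ : s - z ≠ 0 := sub_ne_zero.2 fun h => by rw [h] at hs; linarith
  have h₂ : s - conj z ≠ 0 := sub_ne_zero.2 fun h => by rw [h, Complex.conj_re] at hs; linarith
  simp only [map_div₀, map_add, map_mul, map_sub, Complex.conj_ofReal, Complex.conj_conj,
    ← neg_sub z (conj z)]
  field_simp
  ring

theorem stable_linear_div_quadratic {a b : ℝ} (ha : 0 < a) (hb : 0 < b) (α β : ℝ) :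
    Stable (fun s => (α * s + β) / (s ^ 2 + b * s + a)) := by
  rcases le_or_gt (4 * a) (b ^ 2) with hd | hd
  · obtain ⟨e, he0, he⟩ : ∃ e : ℝ, 0 ≤ e ∧ e ^ 2 = b ^ 2 - 4 * a :=
      ⟨_, Real.sqrt_nonneg _, Real.sq_sqrt (by linarith)⟩
    have hp : 0 < (b - e) / 2 := by nlinarith
    have hr : 0 < (b + e) / 2 := by linarith
    refine ((stable_linear_div_linear hp α β).mul (stable_inv_add hr)).congr fun s _ _ => ?_
    have heC : (e : ℂ) ^ 2 = b ^ 2 - 4 * a := by exact_mod_cast he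
    rw [← div_eq_mul_inv, div_div]
    congr 1
    push_cast
    linear_combination heC / 4
  · obtain ⟨e, he0, he⟩ : ∃ e : ℝ, 0 < e ∧ e ^ 2 = 4 * a - b ^ 2 :=
      ⟨_, Real.sqrt_pos.2 (sub_pos.2 hd), Real.sq_sqrt (by linarith)⟩
    refine (stable_linear_div_of_im_ne_zero (z := ⟨-(b / 2), e / 2⟩) (by simpa)
      (by simpa using he0.ne') α β).congr fun s _ _ => ?_
    congr 1
    apply Complex.ext <;> simp [pow_two]
    · linear_combination -he / 4
    · ring

theorem stable_quadratic_div_quadratic {a b : ℝ} (ha : 0 < a) (hb : 0 < b) (α β γ : ℝ) :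
    Stable (fun s => (α * s ^ 2 + β * s + γ) / (s ^ 2 + b * s + a)) := by
  refine ((Stable.const α).add
    (stable_linear_div_quadratic ha hb (β - α * b) (γ - α * a))).congr fun s hs _ => ?_
  have hq := quadratic_ne_zero ha hb hs
  rw [div_eq_iff hq, add_mul, div_mul_cancel₀ _ hq]
  push_cast
  ring

end RationalFunctions

/-! ### Integrating plants and small gain -/

theorem hasIntegrator_zero_iff {F : ℂ → ℂ} : HasIntegrator F 0 ↔ Stable F := by
  simp only [HasIntegrator, Complex.ofReal_zero, zero_div, sub_zero]

namespace HasIntegrator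

variable {P Q : ℂ → ℂ} {g h : ℝ}

theorem congr (hP : HasIntegrator P g) (hPQ : ∀ s : ℂ, 0 ≤ s.re → s ≠ 0 → Q s = P s) :
    HasIntegrator Q g :=
  Stable.congr hP fun s hs h0 => by rw [hPQ s hs h0]

theorem add (hP : HasIntegrator P g) (hQ : HasIntegrator Q h) :
    HasIntegrator (fun s => P s + Q s) (g + h) :=
  (Stable.add hP hQ).congr fun s _ _ => by push_cast; ring

theorem const_mul (r : ℝ) (hP : HasIntegrator P g) : HasIntegrator (fun s => r * P s) (r * g) :=
  (Stable.const_mul r hP).congr fun s _ _ => by push_cast; ring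

theorem neg (hP : HasIntegrator P g) : HasIntegrator (fun s => -P s) (-g) :=
  (Stable.neg hP).congr fun s _ _ => by push_cast; ring

theorem sub (hP : HasIntegrator P g) (hQ : HasIntegrator Q h) :
    HasIntegrator (fun s => P s - Q s) (g - h) :=
  (Stable.sub hP hQ).congr fun s _ _ => by push_cast; ring

theorem mul_stable (hP : HasIntegrator P g) (hQ : Stable Q) (hQs : Stable (fun s => Q s / s)) :
    Stable (fun s => P s * Q s) :=
  ((Stable.mul hP hQ).add (hQs.const_mul g)).congr fun s _ _ => by ring

theorem comp_mul {k : ℝ} (hk : 0 < k) (hP : HasIntegrator P g) :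
    HasIntegrator (fun s => P (k * s)) (g / k) :=
  (Stable.comp_mul hk hP).congr fun s _ _ => by
    rw [Complex.ofReal_div, div_div]

theorem mul_inv_add_one (hP : HasIntegrator P g) :
    HasIntegrator (fun s => P s * (s + (1 : ℝ))⁻¹) g := by
  have lag := stable_inv_add one_pos
  refine ((Stable.mul hP lag).sub (lag.const_mul g)).congr fun s hs h0 => ?_
  have hne := add_ofReal_ne_zero one_pos hs
  field_simp
  push_cast
  ring

end HasIntegrator

theorem one_add_ofReal_mul_ne_zero {r : ℝ} (hr : 0 ≤ r) {s : ℂ} (hs : 0 ≤ s.re) :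
    1 + r * s ≠ 0 := fun h => by
  have := congrArg Complex.re h
  rw [Complex.add_re, Complex.one_re, Complex.re_ofReal_mul, Complex.zero_re] at this
  linarith [mul_nonneg hr hs]

theorem IsPI.exists_hasIntegrator {C : ℂ → ℂ} (hC : IsPI C) : ∃ r, HasIntegrator C r := by
  obtain ⟨Kp, TI, TF, -, hI, hF, hC⟩ := hC
  have lag := stable_inv_add (inv_pos.2 hF)
  refine ⟨-(Kp / TI), (lag.const_mul (-(Kp * (1 - TF / TI) / TF))).congr fun s hs h0 => ?_⟩
  have hI0 : (TI : ℂ) ≠ 0 := by exact_mod_cast hI.ne'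
  have hF0 : (TF : ℂ) ≠ 0 := by exact_mod_cast hF.ne'
  have hne := one_add_ofReal_mul_ne_zero hF.le hs
  have hlag : (s + (TF⁻¹ : ℝ))⁻¹ = TF / (1 + TF * s) := by
    rw [Complex.ofReal_inv, ← mul_inv_cancel₀ hF0, ← mul_add, add_comm, ← div_div, div_self hF0,
      one_div]
  rw [hC, hlag]
  generalize hq : 1 + (TF : ℂ) * s = q at hne ⊢
  push_cast
  field_simp
  linear_combination -(Kp : ℂ) * hq

section ClosedLoop

variable {P C : ℂ → ℂ}

theorem closedLoopStable_of_mul_eq_one_add {U Δ : ℂ → ℂ} {ε : ℝ} {M : ℝ≥0} (hε : 0 < ε)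
    (hΔ : StableWith ε M Δ) (hM : M < 1) (hU : Stable U) (hPU : Stable (fun s => P s * U s))
    (hCU : Stable (fun s => C s * U s))
    (h : ∀ s : ℂ, 0 ≤ s.re → s ≠ 0 → (1 - P s * C s) * U s = 1 + Δ s) : ClosedLoopStable P C := by
  have hinv : Stable (fun s => (1 + Δ s)⁻¹) := (hΔ.inv_one_add hε.le hM).stable hε
  have hne : ∀ s : ℂ, 0 ≤ s.re → s ≠ 0 → (1 - P s * C s) * U s ≠ 0 := fun s hs h0 =>
    (h s hs h0).trans_ne (hΔ.one_add_ne_zero hε.le hM hs h0)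
  have hS : ∀ s : ℂ, 0 ≤ s.re → s ≠ 0 → (1 - P s * C s)⁻¹ = U s * (1 + Δ s)⁻¹ := fun s hs h0 => by
    rw [← h s hs h0, mul_inv_rev, mul_inv_cancel_left₀ (right_ne_zero_of_mul (hne s hs h0))]
  refine ⟨fun s hs h0 => left_ne_zero_of_mul (hne s hs h0), (hU.mul hinv).congr hS,
    (hPU.mul hinv).congr fun s hs h0 => ?_, (hCU.mul hinv).congr fun s hs h0 => ?_⟩
  · rw [hS s hs h0, mul_assoc]
  · rw [hS s hs h0, mul_assoc]

theorem ClosedLoopStable.of_comp_mul {k : ℝ} (hk : 0 < k)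
    (h : ClosedLoopStable (fun s => P (k * s)) fun s => C (k * s)) : ClosedLoopStable P C := by
  obtain ⟨h₁, h₂, h₃, h₄⟩ := h
  refine ⟨fun s hs h0 => ?_, .of_comp_mul hk h₂, .of_comp_mul hk h₃, .of_comp_mul hk h₄⟩
  have hk0 : (k : ℂ) ≠ 0 := by exact_mod_cast hk.ne'
  have := h₁ ((k⁻¹ : ℝ) * s) (by rw [Complex.re_ofReal_mul]; positivity)
    (mul_ne_zero (by simpa using hk.ne') h0)
  simpa only [Complex.ofReal_inv, mul_inv_cancel_left₀ hk0] using this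

end ClosedLoop

/-! ### Slow PI control -/

/-- The PI compensator with proportional gain `k b`, integral time `b / (a k)` and filter time `1`.
In the time scale `1 / k` its PI part is `k (b + a / s)`, so that for small `k` a plant with
integrator gain `g` gives a loop with characteristic polynomial close to `s ^ 2 + g b s + g a`. -/
def piCompensator (k a b : ℝ) (s : ℂ) : ℂ :=
  -(k * (b + a * k / s)) * (s + (1 : ℝ))⁻¹

theorem isPI_piCompensator {k a b : ℝ} (hk : 0 < k) (ha : 0 < a) (hb : 0 < b) :
    IsPI (piCompensator k a b) := by
  refine ⟨k * b, b / (a * k), 1, by positivity, by positivity, one_pos, fun s => ?_⟩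
  have hb0 : (b : ℂ) ≠ 0 := by exact_mod_cast hb.ne'
  simp only [piCompensator, Complex.ofReal_mul, Complex.ofReal_div, Complex.ofReal_one, one_mul,
    one_div, mul_inv, inv_div, add_comm s]
  field_simp

/-- Relative perturbation of the nominal characteristic polynomial `s ^ 2 + g b₀ s + g a₀` when the
PI gains are `a`, `b` and the plant is `g / s + E`. -/
def characteristicPerturbation (g a₀ b₀ a b : ℝ) (E : ℂ → ℂ) (s : ℂ) : ℂ :=
  ((g * (b - b₀) : ℝ) * s + (g * (a - a₀) : ℝ)) / (s ^ 2 + (g * b₀ : ℝ) * s + (g * a₀ : ℝ)) +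
    (b * s ^ 2 + a * s + (0 : ℝ)) / (s ^ 2 + (g * b₀ : ℝ) * s + (g * a₀ : ℝ)) * E s

section LowGain

variable {P E : ℂ → ℂ} {a b : ℝ → ℝ} {g a₀ b₀ : ℝ}

theorem exists_stableWith_characteristicPerturbation (hE : Stable E) (hg : 0 < g) (ha₀ : 0 < a₀)
    (hb₀ : 0 < b₀) (ha : Tendsto a (𝓝[>] 0) (𝓝 a₀)) (hb : Tendsto b (𝓝[>] 0) (𝓝 b₀)) :
    ∃ ε > 0, ∃ m : ℝ → ℝ≥0, Tendsto m (𝓝[>] 0) (𝓝 0) ∧ ∀ᶠ k in 𝓝[>] 0, StableWith ε (m k)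
      (characteristicPerturbation g a₀ b₀ (a k) (b k) fun s => k * E (k * s)) := by
  have hq := stable_quadratic_div_quadratic (mul_pos hg ha₀) (mul_pos hg hb₀)
  obtain ⟨ε, hε, ⟨N₀, h₀⟩, ⟨N₁, h₁⟩, ⟨N₂, h₂⟩, ⟨N, hN⟩⟩ := (eventually_mem_nhdsWithin.and
    ((hq 0 0 1).eventually_stableWith.and ((hq 0 1 0).eventually_stableWith.and
      ((hq 1 0 0).eventually_stableWith.and hE.eventually_stableWith)))).exists
  have hε₀ : 0 ≤ ε := (mem_Ioi.1 hε).le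
  have hk : Tendsto (fun k : ℝ => k) (𝓝[>] 0) (𝓝 0) := nhdsWithin_le_nhds
  refine ⟨ε, hε, fun k => ‖g * (b k - b₀)‖₊ * N₁ + ‖g * (a k - a₀)‖₊ * N₀ +
    (‖b k‖₊ * N₂ + ‖a k‖₊ * N₁) * (‖k‖₊ * N), ?_, ?_⟩
  · have hlim := ((((hb.sub_const b₀).const_mul g).nnnorm.mul_const N₁).add
      (((ha.sub_const a₀).const_mul g).nnnorm.mul_const N₀)).add
      (((hb.nnnorm.mul_const N₂).add (ha.nnnorm.mul_const N₁)).mul (hk.nnnorm.mul_const N))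
    simpa using hlim
  · filter_upwards [self_mem_nhdsWithin, hk.eventually_le_const one_pos] with k hk₀ hk₁
    have hEk : StableWith ε N fun s => E (k * s) :=
      (hN.mono (mul_le_of_le_one_right hε₀ hk₁)).comp_mul hk₀
    refine (((h₁.const_mul hε₀ (g * (b k - b₀))).add hε₀
      (h₀.const_mul hε₀ (g * (a k - a₀)))).add hε₀
      (((h₂.const_mul hε₀ (b k)).add hε₀ (h₁.const_mul hε₀ (a k))).mul hε₀
        (hEk.const_mul hε₀ k))).congr fun s _ _ => ?_
    simp only [characteristicPerturbation]
    push_cast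
    ring

theorem one_sub_mul_piCompensator {k : ℝ} (hk : k ≠ 0) (hg : 0 < g) (ha₀ : 0 < a₀) (hb₀ : 0 < b₀)
    {a b : ℝ} {s : ℂ} (hs : 0 ≤ s.re) (h0 : s ≠ 0) :
    (1 - P (k * s) * piCompensator k a b (k * s)) *
        (s ^ 2 / (s ^ 2 + (g * b₀ : ℝ) * s + (g * a₀ : ℝ))) =
      1 + characteristicPerturbation g a₀ b₀ a b
        (fun s => k * (P (k * s) * (k * s + (1 : ℝ))⁻¹ - g / (k * s))) s := by
  have hk0 : (k : ℂ) ≠ 0 := by exact_mod_cast hk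
  have hq := quadratic_ne_zero (mul_pos hg ha₀) (mul_pos hg hb₀) hs
  simp only [characteristicPerturbation, piCompensator]
  generalize (k * s + (1 : ℝ) : ℂ)⁻¹ = x
  push_cast at hq ⊢
  generalize hdef : s ^ 2 + g * b₀ * s + g * a₀ = q at hq ⊢
  field_simp
  linear_combination s * hdef

theorem eventually_closedLoopStable_piCompensator (hP : HasIntegrator P g) (hg : 0 < g)
    (ha₀ : 0 < a₀) (hb₀ : 0 < b₀) (ha : Tendsto a (𝓝[>] 0) (𝓝 a₀))
    (hb : Tendsto b (𝓝[>] 0) (𝓝 b₀)) :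
    ∀ᶠ k in 𝓝[>] 0, ClosedLoopStable P (piCompensator k (a k) (b k)) := by
  obtain ⟨ε, hε, m, hm, hΔ⟩ :=
    exists_stableWith_characteristicPerturbation hP.mul_inv_add_one hg ha₀ hb₀ ha hb
  have hq := stable_quadratic_div_quadratic (mul_pos hg ha₀) (mul_pos hg hb₀)
  have hU : Stable fun s => s ^ 2 / (s ^ 2 + (g * b₀ : ℝ) * s + (g * a₀ : ℝ)) :=
    (hq 1 0 0).congr fun s _ _ => by simp
  have hUs : Stable fun s => s ^ 2 / (s ^ 2 + (g * b₀ : ℝ) * s + (g * a₀ : ℝ)) / s :=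
    (hq 0 1 0).congr fun s _ _ => by
      simp only [Complex.ofReal_zero, Complex.ofReal_one, zero_mul, one_mul, zero_add, add_zero]
      rw [div_right_comm, pow_two, mul_self_div_self]
  filter_upwards [self_mem_nhdsWithin, hΔ, hm.eventually_lt_const one_pos,
    ha.eventually_const_lt ha₀, hb.eventually_const_lt hb₀] with k hk hΔ hm ha hb
  obtain ⟨r, hC⟩ := (isPI_piCompensator hk ha hb).exists_hasIntegrator
  exact (closedLoopStable_of_mul_eq_one_add hε hΔ hm hU ((hP.comp_mul hk).mul_stable hU hUs)
    ((hC.comp_mul hk).mul_stable hU hUs) fun s hs h0 =>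
      one_sub_mul_piCompensator hk.ne' hg ha₀ hb₀ hs h0).of_comp_mul hk

end LowGain

/-! ### Phase margin -/

section FrequencyResponse

variable {P : ℂ → ℂ} {g : ℝ}

theorem re_I_mul_ofReal_nonneg (ω : ℝ) : 0 ≤ (Complex.I * ω).re := by simp

theorem I_mul_ofReal_ne_zero {ω : ℝ} (hω : 0 < ω) : Complex.I * ω ≠ 0 := by simp [hω.ne']

theorem strictAntiOn_norm_div {f : ℝ → ℂ} {S : Set ℝ} {L : ℝ≥0} (hS : S ⊆ Ioi 0)
    (hf : LipschitzOnWith L f S) (h : ∀ u ∈ S, L * u < ‖f u‖) :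
    StrictAntiOn (fun u => ‖f u‖ / u) S := by
  intro u hu v hv huv
  have hdist : ‖f v‖ - ‖f u‖ ≤ L * (v - u) := by
    rw [← abs_of_pos (sub_pos.2 huv), ← Real.dist_eq]
    exact (norm_sub_norm_le _ _).trans (dist_eq_norm (f v) (f u) ▸ hf.dist_le_mul v hv u hu)
  have hu₀ : 0 < u := hS hu
  refine (div_lt_div_iff₀ (hS hv) hu₀).2 ?_
  nlinarith [h u hu, mul_le_mul_of_nonneg_left hdist hu₀.le]

theorem lipschitzOnWith_add_I_mul {f : ℝ → ℂ} {K B w : ℝ≥0} (c : ℂ)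
    (hf : LipschitzOnWith K f (Ioc 0 w)) (hB : ∀ u ∈ Ioc 0 (w : ℝ), ‖f u‖ ≤ B) :
    LipschitzOnWith (B + w * K) (fun u => c + Complex.I * u * f u) (Ioc 0 w) := by
  refine LipschitzOnWith.of_dist_le_mul fun u hu v hv => ?_
  have hsplit : Complex.I * u * f u - Complex.I * v * f v =
      Complex.I * ((u - v : ℝ) * f u + v * (f u - f v)) := by
    push_cast
    ring
  calc dist (c + Complex.I * u * f u) (c + Complex.I * v * f v)
      ≤ ‖u - v‖ * ‖f u‖ + ‖v‖ * ‖f u - f v‖ := by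
        rw [dist_add_left, dist_eq_norm, hsplit, norm_mul, Complex.norm_I, one_mul,
          ← Complex.norm_real, ← Complex.norm_real, ← norm_mul, ← norm_mul]
        exact norm_add_le _ _
    _ ≤ ‖u - v‖ * B + w * (K * dist u v) := by
        rw [Real.norm_of_nonneg hv.1.le]
        gcongr
        · exact hB u hu
        · exact hv.2
        · exact dist_eq_norm (f u) (f v) ▸ hf.dist_le_mul u hu v hv
    _ = ↑(B + w * K) * dist u v := by
        rw [← dist_eq_norm]
        push_cast
        ring

namespace HasIntegrator

theorem exists_norm_le (hP : HasIntegrator P g) :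
    ∃ B : ℝ, ∀ ω : ℝ, 0 < ω → ‖P (Complex.I * ω)‖ ≤ ‖g‖ / ω + B := by
  obtain ⟨B, hB⟩ := Stable.exists_norm_le hP
  refine ⟨B, fun ω hω => ?_⟩
  have hnorm : ‖(g : ℂ) / (Complex.I * ω)‖ = ‖g‖ / ω := by
    rw [norm_div, norm_mul, Complex.norm_I, one_mul, Complex.norm_real, Complex.norm_real,
      Real.norm_of_nonneg hω.le]
  rw [← hnorm]
  exact norm_le_norm_add_norm_sub' _ _ |>.trans (add_le_add_right
    (hB _ (re_I_mul_ofReal_nonneg ω) (I_mul_ofReal_ne_zero hω)) _)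

theorem tendsto_mul (hP : HasIntegrator P g) :
    Tendsto (fun ω : ℝ => Complex.I * ω * P (Complex.I * ω)) (𝓝[>] 0) (𝓝 g) := by
  obtain ⟨B, hB⟩ := Stable.exists_norm_le hP
  have hlim : Tendsto (fun ω : ℝ => ω * (B : ℝ)) (𝓝[>] 0) (𝓝 0) := by
    have hid : Tendsto (fun ω : ℝ => ω) (𝓝[>] 0) (𝓝 0) := nhdsWithin_le_nhds
    simpa only [zero_mul] using hid.mul_const (B : ℝ)
  refine tendsto_iff_norm_sub_tendsto_zero.2
    (squeeze_zero' (Eventually.of_forall fun _ => norm_nonneg _) ?_ hlim)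
  filter_upwards [self_mem_nhdsWithin] with ω hω
  have hI := I_mul_ofReal_ne_zero hω
  calc ‖Complex.I * ω * P (Complex.I * ω) - g‖
      = ω * ‖P (Complex.I * ω) - g / (Complex.I * ω)‖ := by
        rw [← mul_div_cancel₀ (g : ℂ) hI, mul_div_assoc, ← mul_sub, norm_mul, norm_mul,
          Complex.norm_I, one_mul, Complex.norm_real, Real.norm_of_nonneg (mem_Ioi.1 hω).le,
          mul_div_cancel₀ _ hI]
    _ ≤ ω * B := mul_le_mul_of_nonneg_left (hB _ (re_I_mul_ofReal_nonneg ω) hI)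
        (mem_Ioi.1 hω).le

theorem exists_strictAntiOn_norm (hP : HasIntegrator P g) (hg : 0 < g) :
    ∃ w > 0, StrictAntiOn (fun ω : ℝ => ‖P (Complex.I * ω)‖) (Ioc 0 w) := by
  obtain ⟨B, hB⟩ := Stable.exists_norm_le hP
  obtain ⟨K, hK⟩ := Stable.exists_lipschitzOnWith hP
  have hf : LipschitzOnWith (B + 1 * K) (fun ω : ℝ => Complex.I * ω * P (Complex.I * ω))
      (Ioc 0 1) := by
    have hEqOn : EqOn (fun ω : ℝ => Complex.I * ω * P (Complex.I * ω))
        (fun ω => g + Complex.I * ω * (P (Complex.I * ω) - g / (Complex.I * ω))) (Ioc 0 1) :=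
      fun ω hω => by
        simp only [mul_sub, mul_div_cancel₀ _ (I_mul_ofReal_ne_zero hω.1), add_sub_cancel]
    intro u hu v hv
    rw [hEqOn hu, hEqOn hv]
    exact lipschitzOnWith_add_I_mul (w := 1) (g : ℂ) (hK.mono fun ω hω => hω.1)
      (fun ω hω => hB _ (re_I_mul_ofReal_nonneg ω) (I_mul_ofReal_ne_zero hω.1)) hu hv
  have hlt : ∀ᶠ ω : ℝ in 𝓝[>] 0, ↑(B + 1 * K) * ω < ‖Complex.I * ω * P (Complex.I * ω)‖ := by
    have hid : Tendsto (fun ω : ℝ => ω) (𝓝[>] 0) (𝓝 0) := nhdsWithin_le_nhds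
    refine (hid.const_mul _).eventually_lt hP.tendsto_mul.norm ?_
    rwa [mul_zero, Complex.norm_real, Real.norm_of_nonneg hg.le]
  obtain ⟨w, hw, hlt⟩ := mem_nhdsGT_iff_exists_Ioc_subset.1 hlt
  have hanti := strictAntiOn_norm_div (S := Ioc 0 (min w 1)) (fun ω hω => hω.1)
    (hf.mono (Ioc_subset_Ioc_right (min_le_right _ _)))
    fun ω hω => hlt ⟨hω.1, hω.2.trans (min_le_left _ _)⟩
  refine ⟨min w 1, lt_min hw one_pos, hanti.congr fun ω hω => ?_⟩
  simp only [norm_mul, Complex.norm_I, one_mul, Complex.norm_real, Real.norm_of_nonneg hω.1.le]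
  exact mul_div_cancel_left₀ _ hω.1.ne'

end HasIntegrator

theorem antitoneOn_norm_add_div (b c : ℝ) :
    AntitoneOn (fun ω : ℝ => ‖(b + c / (Complex.I * ω) : ℂ)‖) (Ioi 0) := by
  intro u hu v _ huv
  have hnorm : ∀ ω : ℝ, ‖(b + c / (Complex.I * ω) : ℂ)‖ = √(b ^ 2 + (c / ω) ^ 2) := fun ω => by
    rw [← neg_sq (c / ω), ← Complex.norm_add_mul_I, mul_comm Complex.I, ← div_div, Complex.div_I]
    push_cast
    rw [neg_mul]
  simp only [hnorm, div_pow]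
  have hu₀ : 0 < u := hu
  gcongr

section PhaseMargin

variable {a b : ℝ → ℝ} {a₀ b₀ : ℝ}

theorem mul_piCompensator (k a b : ℝ) (s : ℂ) : P s * piCompensator k a b s =
    -(k * (b + (a * k : ℝ) / s)) * (P s * (s + (1 : ℝ))⁻¹) := by
  rw [piCompensator]
  push_cast
  ring

theorem norm_mul_piCompensator (k a b : ℝ) (s : ℂ) : ‖P s * piCompensator k a b s‖ =
    ‖k‖ * (‖b + (a * k : ℝ) / s‖ * ‖P s * (s + (1 : ℝ))⁻¹‖) := by
  rw [mul_piCompensator, norm_mul, norm_neg, norm_mul (k : ℂ), Complex.norm_real, mul_assoc]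

theorem strictAntiOn_norm_mul_piCompensator {k a b w : ℝ} (hk : k ≠ 0) (hb : b ≠ 0)
    (hP : StrictAntiOn (fun ω : ℝ => ‖P (Complex.I * ω) * (Complex.I * ω + (1 : ℝ))⁻¹‖)
      (Ioc 0 w)) :
    StrictAntiOn (fun ω : ℝ => ‖P (Complex.I * ω) * piCompensator k a b (Complex.I * ω)‖)
      (Ioc 0 w) := by
  intro u hu v hv huv
  have hne : (b + (a * k : ℝ) / (Complex.I * u) : ℂ) ≠ 0 := fun h => hb <| by
    simpa [Complex.div_re] using congrArg Complex.re h
  simp only [norm_mul_piCompensator]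
  refine mul_lt_mul_of_pos_left ?_ (norm_pos_iff.2 hk)
  exact mul_lt_mul_of_le_of_lt_of_nonneg_of_pos (antitoneOn_norm_add_div b (a * k) hu.1 hv.1 huv.le)
    (hP hu hv huv) (norm_nonneg _) (norm_pos_iff.2 hne)

theorem eventually_norm_mul_piCompensator_lt_one (hP : HasIntegrator P g)
    (ha : Tendsto a (𝓝[>] 0) (𝓝 a₀)) (hb : Tendsto b (𝓝[>] 0) (𝓝 b₀)) {w : ℝ} (hw : 0 < w) :
    ∀ᶠ k in 𝓝[>] 0, ∀ ω : ℝ, w < ω →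
      ‖P (Complex.I * ω) * piCompensator k (a k) (b k) (Complex.I * ω)‖ < 1 := by
  obtain ⟨B, hB⟩ := hP.mul_inv_add_one.exists_norm_le
  have hk : Tendsto (fun k : ℝ => k) (𝓝[>] 0) (𝓝 0) := nhdsWithin_le_nhds
  have hlim : Tendsto (fun k => ‖k‖ * (‖b k‖ + ‖a k * k‖ / w) * (‖g‖ / w + B)) (𝓝[>] 0) (𝓝 0) := by
    simpa using (hk.norm.mul (hb.norm.add ((ha.mul hk).norm.div_const w))).mul_const (‖g‖ / w + B)
  filter_upwards [hlim.eventually_lt_const one_pos] with k hlt ω hω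
  have hω₀ : 0 < ω := hw.trans hω
  refine lt_of_le_of_lt ?_ hlt
  rw [norm_mul_piCompensator, mul_assoc]
  gcongr
  · refine (norm_add_le _ _).trans ?_
    rw [norm_div, norm_mul, Complex.norm_I, one_mul, Complex.norm_real, Complex.norm_real,
      Complex.norm_real, Real.norm_of_nonneg hω₀.le]
    gcongr
  · exact (hB ω hω₀).trans (by gcongr)

theorem eventually_subsingleton_crossover (hP : HasIntegrator P g) (hg : 0 < g)
    (ha : Tendsto a (𝓝[>] 0) (𝓝 a₀)) (hb : Tendsto b (𝓝[>] 0) (𝓝 b₀)) (hb₀ : b₀ ≠ 0) :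
    ∀ᶠ k in 𝓝[>] 0, {ω : ℝ | 0 < ω ∧
      ‖P (Complex.I * ω) * piCompensator k (a k) (b k) (Complex.I * ω)‖ = 1}.Subsingleton := by
  obtain ⟨w, hw, hanti⟩ := hP.mul_inv_add_one.exists_strictAntiOn_norm hg
  filter_upwards [self_mem_nhdsWithin, hb.eventually_ne hb₀,
    eventually_norm_mul_piCompensator_lt_one hP ha hb hw] with k hk hb hlt
  have hmem : ∀ ω : ℝ, 0 < ω →
      ‖P (Complex.I * ω) * piCompensator k (a k) (b k) (Complex.I * ω)‖ = 1 → ω ∈ Ioc 0 w :=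
    fun ω hω h => ⟨hω, le_of_not_gt fun hgt => (hlt ω hgt).ne h⟩
  exact fun u hu v hv =>
    (strictAntiOn_norm_mul_piCompensator (mem_Ioi.1 hk).ne' hb hanti).injOn
      (hmem u hu.1 hu.2) (hmem v hv.1 hv.2) (hu.2.trans hv.2.symm)

theorem mul_piCompensator_of_crossover {k : ℝ} (hk : k ≠ 0) (z : ℂ) :
    P (Complex.I * k) * piCompensator k z.re z.im (Complex.I * k) =
      Complex.I * k * (P (Complex.I * k) * (Complex.I * k + (1 : ℝ))⁻¹) * z := by
  have hk₀ : (k : ℂ) ≠ 0 := Complex.ofReal_ne_zero.2 hk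
  rw [mul_piCompensator]
  generalize P (Complex.I * k) * (Complex.I * k + (1 : ℝ))⁻¹ = r
  conv_rhs => rw [← z.re_add_im]
  push_cast
  field_simp
  linear_combination -(r * (z.re + z.im * Complex.I)) * Complex.I_sq

theorem hasPhaseMargin_of_mul_eq_exp {C : ℂ → ℂ} {φ k : ℝ} (hk : 0 < k)
    (hPC : P (Complex.I * k) * C (Complex.I * k) =
      Complex.exp ((φ * (Real.pi / 180) : ℝ) * Complex.I))
    (hunique : {ω : ℝ | 0 < ω ∧ ‖P (Complex.I * ω) * C (Complex.I * ω)‖ = 1}.Subsingleton) :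
    HasPhaseMargin P C φ := by
  have hone := (congrArg norm hPC).trans (Complex.norm_exp_ofReal_mul_I _)
  refine ⟨k, hk, fun ω hω => ⟨fun h => hunique ⟨hω, h⟩ ⟨hk, hone⟩, fun h => h ▸ hone⟩, ?_⟩
  have hphase : (((-180 + φ) * (Real.pi / 180) : ℝ) : ℂ) * Complex.I =
      (φ * (Real.pi / 180) : ℝ) * Complex.I - Real.pi * Complex.I := by
    push_cast
    ring
  rw [hphase, Complex.exp_sub, Complex.exp_pi_mul_I, div_neg, div_one]
  exact congrArg Neg.neg hPC

theorem exists_PI_phaseMargin {φ : ℝ} (hg : 0 < g) (hP : HasIntegrator P g)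
    (hφ₀ : 0 < φ) (hφ₁ : φ < 90) :
    ∃ C, IsPI C ∧ ClosedLoopStable P C ∧ HasPhaseMargin P C φ := by
  set θ : ℝ := φ * (Real.pi / 180) with hθ
  let f : ℝ → ℂ := fun k => Complex.I * k * (P (Complex.I * k) * (Complex.I * k + (1 : ℝ))⁻¹)
  have hf : Tendsto f (𝓝[>] 0) (𝓝 g) := hP.mul_inv_add_one.tendsto_mul
  -- The crossover is placed at `ω = k`: the real and imaginary parts of `z k` are the PI gains for
  -- which the loop gain at `i k` is exactly `exp (i θ)`.
  let z : ℝ → ℂ := fun k => Complex.exp (θ * Complex.I) / f k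
  have hz : Tendsto z (𝓝[>] 0) (𝓝 (Complex.exp (θ * Complex.I) / g)) :=
    tendsto_const_nhds.div hf (Complex.ofReal_ne_zero.2 hg.ne')
  have ha := (Complex.continuous_re.tendsto _).comp hz
  have hb := (Complex.continuous_im.tendsto _).comp hz
  have hθ₀ : 0 < θ := by positivity
  have hθ₁ : θ < Real.pi / 2 := by
    rw [hθ]
    linarith [mul_lt_mul_of_pos_right hφ₁ Real.pi_pos]
  have ha₀ : 0 < (Complex.exp (θ * Complex.I) / g).re := by
    rw [Complex.div_ofReal_re, Complex.exp_ofReal_mul_I_re]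
    exact div_pos (Real.cos_pos_of_mem_Ioo ⟨by linarith [Real.pi_pos], hθ₁⟩) hg
  have hb₀ : 0 < (Complex.exp (θ * Complex.I) / g).im := by
    rw [Complex.div_ofReal_im, Complex.exp_ofReal_mul_I_im]
    exact div_pos (Real.sin_pos_of_pos_of_lt_pi hθ₀ (by linarith [Real.pi_pos])) hg
  obtain ⟨k, hk, hfk, hak, hbk, hstable, hunique⟩ := (eventually_mem_nhdsWithin.and
    ((hf.eventually_ne (Complex.ofReal_ne_zero.2 hg.ne')).and
      ((ha.eventually_const_lt ha₀).and ((hb.eventually_const_lt hb₀).and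
        ((eventually_closedLoopStable_piCompensator hP hg ha₀ hb₀ ha hb).and
          (eventually_subsingleton_crossover hP hg ha hb hb₀.ne')))))).exists
  have hPC : P (Complex.I * k) * piCompensator k (z k).re (z k).im (Complex.I * k) =
      Complex.exp (θ * Complex.I) := by
    rw [mul_piCompensator_of_crossover (mem_Ioi.1 hk).ne']
    exact mul_div_cancel₀ _ hfk
  exact ⟨_, isPI_piCompensator hk hak hbk, hstable, hasPhaseMargin_of_mul_eq_exp hk hPC hunique⟩

end PhaseMargin

end FrequencyResponse

/-! ### Low-frequency behaviour of a closed loop -/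

theorem IsPI.exists_stable_mul_eq_one {C : ℂ → ℂ} (hC : IsPI C) :
    ∃ L, Stable L ∧ ∀ s : ℂ, 0 ≤ s.re → s ≠ 0 → C s * (s * L s) = 1 := by
  obtain ⟨Kp, TI, TF, hK, hI, hF, hC⟩ := hC
  refine ⟨_, stable_linear_div_linear (inv_pos.2 hI) (-(TF / Kp)) (-(1 / Kp)), fun s hs h0 => ?_⟩
  have hK0 : (Kp : ℂ) ≠ 0 := Complex.ofReal_ne_zero.2 hK.ne'
  have hI0 : (TI : ℂ) ≠ 0 := Complex.ofReal_ne_zero.2 hI.ne'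
  have hlag := one_add_ofReal_mul_ne_zero hF.le hs
  have hlead := add_ofReal_ne_zero (inv_pos.2 hI) hs
  have hPI : 1 + 1 / (TI * s) = (s + (TI⁻¹ : ℝ)) / s := by
    push_cast
    field_simp
  rw [hC, hPI]
  generalize s + (TI⁻¹ : ℝ) = q at hlead ⊢
  generalize hr : 1 + (TF : ℂ) * s = r at hlag ⊢
  push_cast
  field_simp
  linear_combination hr

theorem HasIntegrator.gain_eq_zero {P : ℂ → ℂ} {g : ℝ} (hP : HasIntegrator P g)
    (hPs : Stable fun s => P s / s) : g = 0 := by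
  have hlim : Tendsto (fun ω : ℝ => P (Complex.I * ω)) (𝓝[>] 0) (𝓝 0) := by
    have h := (hasIntegrator_zero_iff.2 hPs).tendsto_mul
    rw [Complex.ofReal_zero] at h
    refine h.congr' ?_
    filter_upwards [self_mem_nhdsWithin] with ω hω
    exact mul_div_cancel₀ _ (I_mul_ofReal_ne_zero hω)
  have hI : Tendsto (fun ω : ℝ => Complex.I * ω) (𝓝[>] 0) (𝓝 0) := by
    have : Continuous fun ω : ℝ => Complex.I * ω := by fun_prop
    simpa using (this.tendsto 0).mono_left nhdsWithin_le_nhds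
  have := tendsto_nhds_unique hP.tendsto_mul (hI.mul hlim)
  simpa using this

theorem HasIntegrator.mul_mul {P Q R : ℂ → ℂ} {g h r : ℝ} (hP : HasIntegrator P g)
    (hR : HasIntegrator R h) (hQ : Stable Q) (hQs : Stable fun s => Q s / s)
    (hQs2 : HasIntegrator (fun s => Q s / s ^ 2) r) :
    HasIntegrator (fun s => P s * Q s * R s) (g * r * h) := by
  refine ((((Stable.mul hP hQ).mul hR).add ((hQs.mul hR).const_mul g)).add
    (((Stable.mul hP hQs).const_mul h).add
      (Stable.const_mul (g * h) hQs2))).congr fun s _ h0 => ?_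
  push_cast
  field_simp
  ring

namespace ClosedLoopStable

variable {P C : ℂ → ℂ} {g : ℝ}

theorem congr {P' : ℂ → ℂ} (h : ClosedLoopStable P C)
    (hPP' : ∀ s : ℂ, 0 ≤ s.re → s ≠ 0 → P' s = P s) : ClosedLoopStable P' C :=
  ⟨fun s hs h0 => by rw [hPP' s hs h0]; exact h.1 s hs h0,
    h.2.1.congr fun s hs h0 => by rw [hPP' s hs h0],
    h.2.2.1.congr fun s hs h0 => by rw [hPP' s hs h0],
    h.2.2.2.congr fun s hs h0 => by rw [hPP' s hs h0]⟩

theorem stable_controlSensitivity_div (h : ClosedLoopStable P C) (hP : HasIntegrator P g)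
    (hg : g ≠ 0) : Stable fun s => C s * (1 - P s * C s)⁻¹ / s := by
  obtain ⟨hne, hT, -, hQ⟩ := h
  refine (((hT.sub (Stable.const 1)).sub (Stable.mul hP hQ)).const_mul g⁻¹).congr
    fun s hs h0 => ?_
  have hg0 : (g : ℂ) ≠ 0 := Complex.ofReal_ne_zero.2 hg
  have hinv := mul_inv_cancel₀ (hne s hs h0)
  generalize (1 - P s * C s)⁻¹ = T at hinv ⊢
  push_cast
  field_simp
  linear_combination -s * hinv

theorem sensitivity_eq {L : ℂ → ℂ} {s : ℂ} (hL : C s * (s * L s) = 1) :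
    (1 - P s * C s)⁻¹ = s * (C s * (1 - P s * C s)⁻¹ * L s) := by
  linear_combination -(1 - P s * C s)⁻¹ * hL

theorem stable_sensitivity_div (h : ClosedLoopStable P C) (hC : IsPI C) :
    Stable fun s => (1 - P s * C s)⁻¹ / s := by
  obtain ⟨L, hL, hCL⟩ := hC.exists_stable_mul_eq_one
  refine (h.2.2.2.mul hL).congr fun s hs h0 => ?_
  rw [div_eq_iff h0, mul_comm _ s, ← sensitivity_eq (hCL s hs h0)]

theorem stable_sensitivity_div_sq (h : ClosedLoopStable P C) (hC : IsPI C)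
    (hP : HasIntegrator P g) (hg : g ≠ 0) : Stable fun s => (1 - P s * C s)⁻¹ / s / s := by
  obtain ⟨L, hL, hCL⟩ := hC.exists_stable_mul_eq_one
  refine ((h.stable_controlSensitivity_div hP hg).mul hL).congr fun s hs h0 => ?_
  rw [div_mul_eq_mul_div]
  congr 1
  rw [div_eq_iff h0, mul_comm _ s, ← sensitivity_eq (hCL s hs h0)]

theorem hasIntegrator_controlSensitivity_div_sq (h : ClosedLoopStable P C) (hC : IsPI C)
    (hP : HasIntegrator P g) (hg : g ≠ 0) :
    HasIntegrator (fun s => C s * (1 - P s * C s)⁻¹ / s ^ 2) (-g⁻¹) := by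
  refine (((h.stable_sensitivity_div hC).sub
    (Stable.mul hP (h.stable_controlSensitivity_div hP hg))).const_mul g⁻¹).congr
      fun s hs h0 => ?_
  have hg0 : (g : ℂ) ≠ 0 := Complex.ofReal_ne_zero.2 hg
  have hinv := mul_inv_cancel₀ (h.1 s hs h0)
  beta_reduce
  generalize (1 - P s * C s)⁻¹ = T at hinv ⊢
  push_cast
  field_simp
  linear_combination -s * hinv

end ClosedLoopStable

/-! ### Closing one loop of a multivariable plant -/

section RankOne

variable {ι κ K : Type*} [Fintype ι] [DecidableEq ι] [Fintype κ] [DecidableEq κ]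

theorem isUnit_one_sub_mul_comm {R : Type*} [CommRing R] {A : Matrix ι κ R} {B : Matrix κ ι R} :
    IsUnit (1 - A * B) ↔ IsUnit (1 - B * A) := by
  rw [Matrix.isUnit_iff_isUnit_det, Matrix.isUnit_iff_isUnit_det, Matrix.det_one_sub_mul_comm]

theorem inv_one_sub_mul {R : Type*} [CommRing R] {A : Matrix ι κ R} {B : Matrix κ ι R}
    (h : IsUnit (1 - A * B)) : (1 - A * B)⁻¹ = 1 + A * (1 - B * A)⁻¹ * B := by
  have hBA : (1 - B * A) * (1 - B * A)⁻¹ = 1 := Matrix.mul_nonsing_inv _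
    ((Matrix.isUnit_iff_isUnit_det _).1 (isUnit_one_sub_mul_comm.1 h))
  refine Matrix.inv_eq_right_inv ?_
  calc (1 - A * B) * (1 + A * (1 - B * A)⁻¹ * B)
      = 1 - A * B + A * ((1 - B * A) * (1 - B * A)⁻¹) * B := by
        simp only [Matrix.sub_mul, Matrix.mul_sub, Matrix.mul_add, Matrix.one_mul, Matrix.mul_one,
          Matrix.mul_assoc]
    _ = 1 := by rw [hBA, Matrix.mul_one, sub_add_cancel]

variable [Field K] {L G : Matrix ι ι K} {m : ι} {γ : K}

theorem sub_mul_diagonal_single (hL : IsUnit L) :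
    L - G * Matrix.diagonal (Pi.single m γ) = L * (1 - Matrix.replicateCol Unit ((L⁻¹ * G).col m) *
      Matrix.replicateRow Unit (Pi.single m γ)) := by
  have hdiag : (L⁻¹ * G) * Matrix.diagonal (Pi.single m γ) =
      Matrix.replicateCol Unit ((L⁻¹ * G).col m) * Matrix.replicateRow Unit (Pi.single m γ) := by
    ext i j
    rw [Matrix.mul_diagonal, ← Matrix.vecMulVec_eq, Matrix.vecMulVec_apply, Matrix.col_apply]
    obtain rfl | hj := eq_or_ne j m
    · rfl
    · rw [Pi.single_eq_of_ne hj, mul_zero, mul_zero]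
  rw [← hdiag, Matrix.mul_sub, Matrix.mul_one, Matrix.mul_assoc,
    Matrix.mul_nonsing_inv_cancel_left _ _ ((Matrix.isUnit_iff_isUnit_det L).1 hL)]

theorem isUnit_one_sub_replicateCol_mul {u : ι → K} (h : 1 - u m * γ ≠ 0) :
    IsUnit (1 - Matrix.replicateCol Unit u * Matrix.replicateRow Unit (Pi.single m γ)) := by
  rw [isUnit_one_sub_mul_comm, Matrix.isUnit_iff_isUnit_det, Matrix.det_unique, isUnit_iff_ne_zero]
  simpa [Matrix.mul_apply, mul_comm, Pi.single_apply] using h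

theorem isUnit_sub_mul_diagonal_single (hL : IsUnit L) (h : 1 - (L⁻¹ * G) m m * γ ≠ 0) :
    IsUnit (L - G * Matrix.diagonal (Pi.single m γ)) := by
  rw [sub_mul_diagonal_single hL]
  exact hL.mul (isUnit_one_sub_replicateCol_mul h)

theorem inv_sub_mul_diagonal_single_mul_apply {κ : Type*} (hL : IsUnit L)
    (h : 1 - (L⁻¹ * G) m m * γ ≠ 0) (W : Matrix ι κ K) (k : ι) (l : κ) :
    ((L - G * Matrix.diagonal (Pi.single m γ))⁻¹ * W) k l = (L⁻¹ * W) k l +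
      (L⁻¹ * G) k m * (γ * (1 - (L⁻¹ * G) m m * γ)⁻¹) * (L⁻¹ * W) m l := by
  rw [sub_mul_diagonal_single hL, Matrix.mul_inv_rev,
    inv_one_sub_mul (isUnit_one_sub_replicateCol_mul (u := (L⁻¹ * G).col m) h),
    Matrix.mul_assoc, Matrix.add_mul, Matrix.one_mul, Matrix.add_apply]
  generalize L⁻¹ * W = Y
  generalize L⁻¹ * G = H
  rw [Matrix.inv_subsingleton]
  simp [Matrix.mul_apply, Pi.single_apply, mul_comm, mul_left_comm]

end RankOne

section Gains

open Matrix

variable {ι κ : Type*} [Fintype ι] {S : Set ι} {g : Matrix ι ι ℝ} {m : ι}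

/-- Positivity of the quadratic form of `g` on the vectors that vanish on `S`: the invariant of the
design that makes every next diagonal gain positive. -/
def PositiveOff (S : Set ι) (g : Matrix ι ι ℝ) : Prop :=
  ∀ x : ι → ℝ, (∀ j ∈ S, x j = 0) → x ≠ 0 → 0 < x ⬝ᵥ g *ᵥ x

/-- Elimination of row `m` of `f` by the pivot `g m m`; for `f = g` this is the Schur complement,
with zero row and column `m` kept. -/
def eliminate (g : Matrix ι ι ℝ) (f : Matrix ι κ ℝ) (m : ι) : Matrix ι κ ℝ :=
  f - (g m m)⁻¹ • vecMulVec (g.col m) (f.row m)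

theorem PositiveOff.diag_pos (h : PositiveOff S g) (hm : m ∉ S) : 0 < g m m := by
  classical
  have := h (Pi.single m 1) (fun j hj => Pi.single_eq_of_ne (ne_of_mem_of_not_mem hj hm) _)
    (by simp)
  simpa using this

theorem PositiveOff.eliminate (h : PositiveOff S g) (hm : m ∉ S) :
    PositiveOff (insert m S) (eliminate g g m) := by
  classical
  intro x hx hx0
  have hg := (h.diag_pos hm).ne'
  set t := (g m m)⁻¹ * (g *ᵥ x) m with ht
  -- Off `m`, `x'` agrees with `x`; its entry at `m` makes entry `m` of `g *ᵥ x'` vanish.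
  set x' := x - t • Pi.single m 1 with hx'
  have hgx' : g *ᵥ x' = g *ᵥ x - t • g.col m := by
    rw [hx', mulVec_sub, mulVec_smul, mulVec_single_one]
  have hm0 : (g *ᵥ x') m = 0 := by
    rw [hgx', Pi.sub_apply, Pi.smul_apply, Matrix.col_apply, smul_eq_mul, ht]
    field_simp
    ring
  have hschur : Channel.eliminate g g m *ᵥ x = g *ᵥ x' := by
    rw [hgx', Channel.eliminate, sub_mulVec, smul_mulVec, vecMulVec_mulVec]
    ext i
    simp [ht, mulVec, Matrix.row]
    ring
  have hform : x ⬝ᵥ g *ᵥ x' = x' ⬝ᵥ g *ᵥ x' := by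
    rw [hx', sub_dotProduct, smul_dotProduct, single_one_dotProduct, ← hx', hm0, smul_zero,
      sub_zero]
  have hx'_of_ne {j : ι} (hj : j ≠ m) : x' j = x j := by simp [hx', hj]
  rw [hschur, hform]
  refine h x' (fun j hj => ?_) fun h0 => hx0 (funext fun j => ?_)
  · rw [hx'_of_ne (ne_of_mem_of_not_mem hj hm), hx j (mem_insert_of_mem m hj)]
  · obtain rfl | hj := eq_or_ne j m
    · exact hx j (mem_insert j S)
    · rw [← hx'_of_ne hj, h0]

end Gains

/-- The transfer matrix `X` has at most one integrator per entry, with gains `g`, and the rows in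
`S`, those of the closed loops, reject constant inputs: they stay stable after division by `s`. -/
structure RejectsConstants {ι κ : Type*} (S : Set ι) (X : ℂ → Matrix ι κ ℂ)
    (g : Matrix ι κ ℝ) : Prop where
  integrator : ∀ k l, HasIntegrator (fun s => X s k l) (g k l)
  stable_div : ∀ k ∈ S, ∀ l, Stable fun s => X s k l / s

theorem RejectsConstants.insert {ι κ : Type*} {S : Set ι} {H : ℂ → Matrix ι ι ℂ}
    {X X' : ℂ → Matrix ι κ ℂ} {g : Matrix ι ι ℝ} {f : Matrix ι κ ℝ} {C : ℂ → ℂ} {m : ι}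
    (hH : RejectsConstants S H g) (hX : RejectsConstants S X f) (hg : g m m ≠ 0) (hC : IsPI C)
    (h : ClosedLoopStable (fun s => H s m m) C)
    (hX' : ∀ s : ℂ, 0 ≤ s.re → s ≠ 0 → ∀ k l,
      X' s k l = X s k l + H s k m * (C s * (1 - H s m m * C s)⁻¹) * X s m l) :
    RejectsConstants (insert m S) X' (eliminate g f m) := by
  have hQ := h.2.2.2
  have hQs := h.stable_controlSensitivity_div (hH.integrator m m) hg
  refine ⟨fun k l => ?_, fun k hk l => ?_⟩
  · have hQs2 := h.hasIntegrator_controlSensitivity_div_sq hC (hH.integrator m m) hg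
    have hgain : eliminate g f m k l = f k l + g k m * -(g m m)⁻¹ * f m l := by
      simp only [eliminate, Matrix.sub_apply, Matrix.smul_apply, Matrix.vecMulVec_apply,
        Matrix.col_apply, Matrix.row_apply, smul_eq_mul]
      ring
    rw [hgain]
    exact ((hX.integrator k l).add
      ((hH.integrator k m).mul_mul (hX.integrator m l) hQ hQs hQs2)).congr
        fun s hs h0 => hX' s hs h0 k l
  · have hx := hX.integrator m l
    obtain rfl | hk := hk
    · refine (hx.mul_stable (h.stable_sensitivity_div hC)
        (h.stable_sensitivity_div_sq hC (hH.integrator k k) hg)).congr fun s hs h0 => ?_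
      have hne := h.1 s hs h0
      rw [hX' s hs h0]
      field_simp
      ring
    · refine ((hX.stable_div k hk l).add
        ((hH.stable_div k hk m).mul (hx.mul_stable hQ hQs))).congr fun s hs h0 => ?_
      rw [hX' s hs h0]
      ring

section Design

variable {ι κ : Type*} [Fintype ι] [DecidableEq ι] {G : ℂ → Matrix ι ι ℂ}
  {W : ℂ → Matrix ι κ ℂ} {C : ι → ℂ → ℂ} {S : Set ι} {m : ι}

/-- The matrix `I - G C` with only the compensators of the loops in `S` switched on. -/
def loopMatrixOn (G : ℂ → Matrix ι ι ℂ) (C : ι → ℂ → ℂ) (S : Set ι) (s : ℂ) : Matrix ι ι ℂ :=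
  1 - G s * Matrix.diagonal fun i => S.indicator C i s

/-- The state of a design of `y = G u + W d` in which the loops in `S` have been closed. -/
structure PartialDesign (G : ℂ → Matrix ι ι ℂ) (W : ℂ → Matrix ι κ ℂ) (C : ι → ℂ → ℂ)
    (S : Set ι) : Prop where
  isUnit : ∀ s : ℂ, 0 ≤ s.re → s ≠ 0 → IsUnit (loopMatrixOn G C S s)
  exists_plantGain : ∃ g, PositiveOff S g ∧
    RejectsConstants S (fun s => (loopMatrixOn G C S s)⁻¹ * G s) g
  exists_disturbanceGain : ∃ f, RejectsConstants S (fun s => (loopMatrixOn G C S s)⁻¹ * W s) f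

theorem loopMatrixOn_empty (s : ℂ) : loopMatrixOn G C ∅ s = 1 := by
  simp [loopMatrixOn]

theorem loopMatrixOn_insert (hm : m ∉ S) (s : ℂ) : loopMatrixOn G C (insert m S) s =
    loopMatrixOn G C S s - G s * Matrix.diagonal (Pi.single m (C m s)) := by
  rw [loopMatrixOn, loopMatrixOn, sub_sub, ← Matrix.mul_add, Matrix.diagonal_add]
  congr 3
  ext j
  obtain rfl | hj := eq_or_ne j m
  · simp [hm]
  · rw [Pi.single_eq_of_ne hj, add_zero]
    by_cases hS : j ∈ S <;> simp [hS, hj]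

theorem partialDesign_empty {g : Matrix ι ι ℝ} (hg : PositiveOff ∅ g)
    (hG : ∀ i j, HasIntegrator (fun s => G s i j) (g i j))
    (hW : ∀ i l, ∃ f, HasIntegrator (fun s => W s i l) f) : PartialDesign G W C ∅ := by
  choose f hf using hW
  constructor
  all_goals simp only [loopMatrixOn_empty, inv_one, Matrix.one_mul]
  exacts [fun _ _ _ => isUnit_one, ⟨g, hg, hG, fun _ hk => hk.elim⟩,
    ⟨Matrix.of f, hf, fun _ hk => hk.elim⟩]

theorem PartialDesign.insert (h : PartialDesign G W C S) (hm : m ∉ S) (hC : IsPI (C m))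
    (hst : ClosedLoopStable (fun s => ((loopMatrixOn G C S s)⁻¹ * G s) m m) (C m)) :
    PartialDesign G W C (insert m S) := by
  obtain ⟨hU, ⟨g, hpos, hH⟩, f, hF⟩ := h
  have hg := (hpos.diag_pos hm).ne'
  refine ⟨fun s hs h0 => ?_, ⟨eliminate g g m, hpos.eliminate hm,
    hH.insert hH hg hC hst fun s hs h0 k l => ?_⟩,
    eliminate g f m, hH.insert hF hg hC hst fun s hs h0 k l => ?_⟩
  · rw [loopMatrixOn_insert hm]
    exact isUnit_sub_mul_diagonal_single (hU s hs h0) (hst.1 s hs h0)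
  all_goals
    rw [loopMatrixOn_insert hm]
    exact inv_sub_mul_diagonal_single_mul_apply (hU s hs h0) (hst.1 s hs h0) _ k l

end Design

/-! ### The channel -/

section PlantGain

open Matrix

variable {n : ℕ} {a : Fin (n + 1) → ℝ}

/-- Incidence matrix of the channel: a flow through gate `i` drains pool `i.castSucc` and fills
pool `i.succ`. -/
def incidence (n : ℕ) : Matrix (Fin (n + 1)) (Fin n) ℝ :=
  Matrix.of fun j i => (if j = i.succ then 1 else 0) - (if j = i.castSucc then 1 else 0)

/-- Residue at the origin of the plant whose pools have integrator gains `a`: a weighted Laplacian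
of the channel. -/
def plantGain (a : Fin (n + 1) → ℝ) : Matrix (Fin n) (Fin n) ℝ :=
  (incidence n)ᴴ * diagonal a * incidence n

theorem plantGain_apply (a : Fin (n + 1) → ℝ) (i j : Fin n) :
    plantGain a i j =
      if j = i then a i.succ + a i.castSucc
      else if (j : ℕ) = i + 1 then -a i.succ
      else if (i : ℕ) = j + 1 then -a i.castSucc
      else 0 := by
  rw [plantGain, Matrix.mul_assoc, Matrix.mul_apply]
  simp only [incidence, Matrix.of_apply, diagonal_mul, conjTranspose_apply, star_trivial,
    sub_mul, ite_mul, one_mul, zero_mul, Finset.sum_sub_distrib, Finset.sum_ite_eq',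
    Finset.mem_univ, if_true]
  simp only [Fin.ext_iff, Fin.val_succ, Fin.val_castSucc]
  split_ifs <;> first | omega | ring

theorem incidence_mulVec_apply (x : Fin n → ℝ) (j : Fin (n + 1)) :
    (incidence n *ᵥ x) j =
      (∑ i, if j = i.succ then x i else 0) - ∑ i, if j = i.castSucc then x i else 0 := by
  simp only [mulVec, dotProduct, incidence, Matrix.of_apply, sub_mul, ite_mul, one_mul, zero_mul,
    Finset.sum_sub_distrib]

theorem eq_zero_of_incidence_mulVec_eq_zero {x : Fin n → ℝ} (h : incidence n *ᵥ x = 0) :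
    x = 0 := by
  have hflow (i : Fin n) : x i = ∑ k, if i.castSucc = k.succ then x k else 0 := by
    have hpool := congrFun h i.castSucc
    rw [incidence_mulVec_apply, Pi.zero_apply, sub_eq_zero] at hpool
    rw [hpool]
    simp only [Fin.castSucc_inj, Finset.sum_ite_eq, Finset.mem_univ, if_true]
  suffices H : ∀ (j : Fin (n + 1)) (i : Fin n), i.castSucc = j → x i = 0 from
    funext fun i => H _ i rfl
  intro j
  induction j using Fin.induction with
  | zero =>
    intro i hi
    rw [hflow, hi]
    exact Finset.sum_eq_zero fun k _ => if_neg k.succ_ne_zero.symm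
  | succ j ih =>
    intro i hi
    rw [hflow, hi]
    simpa only [Fin.succ_inj, Finset.sum_ite_eq, Finset.mem_univ, if_true] using ih j rfl

theorem posDef_plantGain (ha : ∀ j, 0 < a j) : (plantGain a).PosDef := by
  refine (PosDef.diagonal ha).conjTranspose_mul_mul_same fun x y hxy => ?_
  refine sub_eq_zero.1 (eq_zero_of_incidence_mulVec_eq_zero ?_)
  rw [mulVec_sub, sub_eq_zero]
  exact hxy

theorem positiveOff_plantGain (ha : ∀ j, 0 < a j) : PositiveOff ∅ (plantGain a) :=
  fun x _ hx => by simpa using (posDef_plantGain ha).dotProduct_mulVec_pos hx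

end PlantGain

section Channel

variable {n : ℕ} {Gin Gout : Fin (n + 1) → ℂ → ℂ} {a : Fin (n + 1) → ℝ}

theorem hasIntegrator_plant (hin : ∀ j, HasIntegrator (Gin j) (a j))
    (hout : ∀ j, HasIntegrator (Gout j) (-a j)) (i j : Fin n) :
    HasIntegrator (fun s => plant Gin Gout s i j) (plantGain a i j) := by
  simp only [plant, plantGain_apply, Matrix.of_apply]
  split_ifs
  · simpa only [sub_neg_eq_add] using (hin i.succ).sub (hout i.castSucc)
  · exact hout i.succ
  · exact (hin i.castSucc).neg
  · exact hasIntegrator_zero_iff.2 (Stable.const 0)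

theorem exists_hasIntegrator_disturbancePlant (hin : ∀ j, HasIntegrator (Gin j) (a j))
    (hout : ∀ j, HasIntegrator (Gout j) (-a j)) (i : Fin n) (l : Fin (n + 3)) :
    ∃ f, HasIntegrator (fun s => disturbancePlant Gin Gout s i l) f := by
  simp only [disturbancePlant, Matrix.of_apply]
  split_ifs
  exacts [⟨_, (hin i.castSucc).neg⟩, ⟨_, (hout i.castSucc).neg⟩, ⟨_, hout i.succ⟩,
    ⟨_, hout i.succ⟩, ⟨_, hasIntegrator_zero_iff.2 (Stable.const 0)⟩]

end Channel

section SequentialClosing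

variable {ι κ p : Type*} [Fintype ι] [DecidableEq ι] [Fintype p] [DecidableEq p]
  {G : ℂ → Matrix ι ι ℂ} {C : ι → ℂ → ℂ} {f : p → ι} {s : ℂ}

theorem loopMatrixOn_range (hf : Function.Injective f) : loopMatrixOn G C (range f) s =
    1 - (G s).submatrix id f * Matrix.diagonal (fun i => C (f i) s) *
      (1 : Matrix ι ι ℂ).submatrix f (Equiv.refl ι) := by
  rw [loopMatrixOn]
  congr 1
  ext k l
  rw [Matrix.mul_diagonal, Matrix.mul_apply]
  simp only [Matrix.mul_diagonal, Matrix.submatrix_apply, id_eq, Equiv.refl_apply,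
    Matrix.one_apply]
  by_cases hl : l ∈ range f
  · obtain ⟨i, rfl⟩ := hl
    simp [hf.eq_iff]
  · have hne (i : p) : f i ≠ l := fun h => hl ⟨i, h⟩
    simp [hne]

theorem inv_loopMatrixOn_range_mul (hf : Function.Injective f)
    (h : IsUnit (loopMatrixOn G C (range f) s)) (W : Matrix ι κ ℂ) :
    (loopMatrixOn G C (range f) s)⁻¹ * W =
      W + (G s).submatrix id f * Matrix.diagonal (fun i => C (f i) s) *
        (1 - (G s).submatrix f f * Matrix.diagonal (fun i => C (f i) s))⁻¹ * W.submatrix f id := by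
  rw [loopMatrixOn_range hf] at h ⊢
  rw [inv_one_sub_mul h, Matrix.add_mul, Matrix.one_mul, Matrix.mul_assoc _ _ W,
    Matrix.one_submatrix_mul, Matrix.one_submatrix_mul]
  rfl

end SequentialClosing

section DesignOrder

variable {n : ℕ} {Gin Gout : Fin (n + 1) → ℂ → ℂ} {a : Fin (n + 1) → ℝ}
  {ν : Equiv.Perm (Fin n)} {C : Fin n → ℂ → ℂ}

/-- The loops closed in the first `m` steps of the design order `ν`. -/
def closedLoops (ν : Equiv.Perm (Fin n)) (m : ℕ) : Set (Fin n) :=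
  {j | (ν.symm j : ℕ) < m}

theorem closedLoops_zero : closedLoops ν 0 = ∅ := by
  simp [closedLoops]

theorem closedLoops_self : closedLoops ν n = univ := by
  simp [closedLoops]

theorem closedLoops_succ (m : Fin n) :
    closedLoops ν (m + 1) = insert (ν m) (closedLoops ν m) := by
  ext j
  rw [closedLoops, mem_ofPred_eq, Nat.lt_succ_iff_lt_or_eq, ← Fin.ext_iff, Equiv.symm_apply_eq,
    or_comm]
  rfl

theorem notMem_closedLoops (m : Fin n) : ν m ∉ closedLoops ν m := by
  simp [closedLoops]

theorem closedLoops_eq_range (m : Fin n) :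
    closedLoops ν m = range fun p : {p : Fin n // p < m} => ν p := by
  ext j
  simp [closedLoops, ← Equiv.eq_symm_apply]

theorem stepPlant_eq {m : Fin n} {s : ℂ}
    (h : IsUnit (loopMatrixOn (plant Gin Gout) C (closedLoops ν m) s)) :
    stepPlant Gin Gout ν C m s =
      ((loopMatrixOn (plant Gin Gout) C (closedLoops ν m) s)⁻¹ * plant Gin Gout s) (ν m) (ν m) := by
  have hcol (k : Fin n) : maskedPlant Gin Gout ν m s k (ν m) = plant Gin Gout s k (ν m) := by
    simp [maskedPlant]
  have hinj : Function.Injective fun p : {p : Fin n // p < m} => ν p :=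
    ν.injective.comp Subtype.val_injective
  calc stepPlant Gin Gout ν C m s
      = ((loopMatrixOn (plant Gin Gout) C (closedLoops ν m) s)⁻¹ *
          maskedPlant Gin Gout ν m s) (ν m) (ν m) := by
        rw [closedLoops_eq_range] at h ⊢
        rw [inv_loopMatrixOn_range_mul hinj h]
        rfl
    _ = _ := by simp only [Matrix.mul_apply, hcol]

theorem partialDesign_closedLoops (ha : ∀ j, 0 < a j) (hin : ∀ j, HasIntegrator (Gin j) (a j))
    (hout : ∀ j, HasIntegrator (Gout j) (-a j)) {m : ℕ} (hm : m ≤ n)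
    (h : ∀ p : Fin n, (p : ℕ) < m → IsPI (C (ν p)) ∧
      ClosedLoopStable (stepPlant Gin Gout ν C p) (C (ν p))) :
    PartialDesign (plant Gin Gout) (disturbancePlant Gin Gout) C (closedLoops ν m) := by
  induction m with
  | zero =>
    rw [closedLoops_zero]
    exact partialDesign_empty (positiveOff_plantGain ha) (hasIntegrator_plant hin hout)
      (exists_hasIntegrator_disturbancePlant hin hout)
  | succ m ih =>
    have hD := ih (Nat.le_of_succ_le hm) fun p hp => h p (hp.trans m.lt_succ_self)
    lift m to Fin n using hm
    obtain ⟨hC, hst⟩ := h m (Nat.lt_succ_self m)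
    rw [closedLoops_succ]
    exact hD.insert (notMem_closedLoops m) hC
      (hst.congr fun s hs h0 => (stepPlant_eq (hD.isUnit s hs h0)).symm)

theorem exists_hasIntegrator_stepPlant (ha : ∀ j, 0 < a j)
    (hin : ∀ j, HasIntegrator (Gin j) (a j)) (hout : ∀ j, HasIntegrator (Gout j) (-a j))
    {m : Fin n} (h : ∀ p < m, IsPI (C (ν p)) ∧
      ClosedLoopStable (stepPlant Gin Gout ν C p) (C (ν p))) :
    ∃ g, 0 < g ∧ HasIntegrator (stepPlant Gin Gout ν C m) g := by
  obtain ⟨hU, ⟨g, hpos, hH⟩, -⟩ := partialDesign_closedLoops ha hin hout m.2.le h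
  exact ⟨g (ν m) (ν m), hpos.diag_pos (notMem_closedLoops m),
    (hH.integrator (ν m) (ν m)).congr fun s hs h0 => stepPlant_eq (hU s hs h0)⟩

theorem isUnit_loopMatrix_and_stable_closedLoop (ha : ∀ j, 0 < a j)
    (hin : ∀ j, HasIntegrator (Gin j) (a j)) (hout : ∀ j, HasIntegrator (Gout j) (-a j))
    (h : ∀ p : Fin n, IsPI (C (ν p)) ∧ ClosedLoopStable (stepPlant Gin Gout ν C p) (C (ν p))) :
    (∀ s : ℂ, 0 ≤ s.re → s ≠ 0 → IsUnit (loopMatrix Gin Gout C s)) ∧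
      ∀ k l, Stable (fun s => closedLoop Gin Gout C s k l) ∧
        Stable fun s => closedLoop Gin Gout C s k l / s := by
  have hall : loopMatrixOn (plant Gin Gout) C (closedLoops ν n) = loopMatrix Gin Gout C := by
    ext1 s
    rw [closedLoops_self, loopMatrixOn, indicator_univ, loopMatrix]
  obtain ⟨hU, -, f, hF⟩ := partialDesign_closedLoops ha hin hout le_rfl fun p _ => h p
  rw [hall] at hU hF
  refine ⟨hU, fun k l => ?_⟩
  have hdiv := hF.stable_div k (closedLoops_self.ge (mem_univ k)) l
  have hint := hF.integrator k l
  rw [hint.gain_eq_zero hdiv, hasIntegrator_zero_iff] at hint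
  exact ⟨hint, hdiv⟩

end DesignOrder

/-! ### Step responses and disturbance rejection -/

section RightHalfPlane

theorem ne_zero_of_re_pos {s : ℂ} (hs : 0 < s.re) : s ≠ 0 := by
  rintro rfl
  simp at hs

theorem neBot_nhdsWithin_re_pos : (𝓝[{s : ℂ | 0 < s.re}] 0).NeBot := by
  rw [← mem_closure_iff_nhdsWithin_neBot, Complex.closure_setOfPred_lt_re]
  simp

theorem eventually_re_pos {z : ℂ} : ∀ᶠ s in 𝓝[{s : ℂ | 0 < s.re}] z, 0 < s.re :=
  self_mem_nhdsWithin

end RightHalfPlane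

section StepResponse

variable {μ : Measure ℝ}

theorem integral_indicator_Iic_mul (t : ℝ) (z : ℂ) :
    ∫ τ, (Iic t).indicator (fun _ => z) τ ∂μ = z * μ.real (Iic t) := by
  rw [integral_indicator_const _ measurableSet_Iic, Complex.real_smul, mul_comm]

variable [IsFiniteMeasure μ]

theorem continuousWithinAt_real_Iic (μ : Measure ℝ) [IsFiniteMeasure μ] (t : ℝ) :
    ContinuousWithinAt (fun t => μ.real (Iic t)) (Ici t) t := by
  rw [← continuousWithinAt_Ioi_iff_Ici]
  have hInter : ⋂ r > t, Iic r = Iic t := by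
    ext x
    simp only [mem_iInter, mem_Iic]
    exact forall_gt_imp_ge_iff_le_of_dense
  have hlim : Tendsto (μ ∘ Iic) (𝓝[>] t) (𝓝 (μ (⋂ r > t, Iic r))) :=
    tendsto_measure_biInter_gt (fun _ _ => nullMeasurableSet_Iic)
      (fun _ _ _ h => Iic_subset_Iic.2 h) ⟨t + 1, by simp, measure_ne_top μ _⟩
  rw [hInter] at hlim
  exact (ENNReal.tendsto_toReal (measure_ne_top μ _)).comp hlim

theorem tendsto_real_Iic_atTop (μ : Measure ℝ) [IsFiniteMeasure μ] :
    Tendsto (fun t => μ.real (Iic t)) atTop (𝓝 (μ.real univ)) :=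
  (ENNReal.tendsto_toReal (measure_ne_top μ _)).comp (tendsto_measure_Iic_atTop μ)

theorem integral_indicator_Iic_exp {s : ℂ} (hs : 0 < s.re) {τ : ℝ} (hτ : 0 ≤ τ) :
    ∫ t in Ioi (0 : ℝ), (Iic t).indicator (fun _ => Complex.exp (-s * (t : ℂ))) τ =
      Complex.exp (-s * (τ : ℂ)) / s := by
  have heq (t : ℝ) : (Iic t).indicator (fun _ => Complex.exp (-s * (t : ℂ))) τ =
      (Ici τ).indicator (fun t : ℝ => Complex.exp (-s * (t : ℂ))) t := rfl
  simp only [heq]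
  rw [← integral_Ici_eq_integral_Ioi, setIntegral_indicator measurableSet_Ici,
    inter_eq_right.2 (Ici_subset_Ici.2 hτ), integral_Ici_eq_integral_Ioi,
    integral_exp_mul_complex_Ioi (by simpa using hs), neg_div_neg_eq]

theorem integrable_indicator_Iic_exp {s : ℂ} (hs : 0 < s.re) :
    Integrable (fun p : ℝ × ℝ => (Iic p.1).indicator (fun _ => Complex.exp (-s * (p.1 : ℂ))) p.2)
      ((volume.restrict (Ioi 0)).prod μ) := by
  have hexp : IntegrableOn (fun t : ℝ => Complex.exp (-s * (t : ℂ))) (Ioi 0) :=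
    integrableOn_exp_mul_complex_Ioi (by simpa using hs) 0
  exact (hexp.integrable.comp_fst μ).indicator (measurableSet_le measurable_snd measurable_fst)

theorem integrableOn_exp_mul_real_Iic {s : ℂ} (hs : 0 < s.re) :
    IntegrableOn (fun t : ℝ => Complex.exp (-s * (t : ℂ)) * (μ.real (Iic t) : ℂ)) (Ioi 0) := by
  simpa only [integral_indicator_Iic_mul] using!
    (integrable_indicator_Iic_exp (μ := μ) hs).integral_prod_left

theorem integral_exp_mul_real_Iic (h0 : μ (Iio 0) = 0) {s : ℂ} (hs : 0 < s.re) :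
    ∫ t in Ioi (0 : ℝ), Complex.exp (-s * (t : ℂ)) * (μ.real (Iic t) : ℂ) = laplace μ s / s := by
  simp only [← integral_indicator_Iic_mul]
  rw [integral_integral_swap (integrable_indicator_Iic_exp hs), laplace, ← integral_div]
  refine integral_congr_ae ?_
  filter_upwards [ae_nonneg_iff.2 h0] with τ hτ using integral_indicator_Iic_exp hs hτ

theorem tendsto_laplace_zero (h0 : μ (Iio 0) = 0) :
    Tendsto (laplace μ) (𝓝[{s : ℂ | 0 < s.re}] 0) (𝓝 (μ.real univ : ℂ)) := by
  have hmass : (μ.real univ : ℂ) = ∫ _, (1 : ℂ) ∂μ := by simp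
  rw [hmass]
  refine tendsto_integral_filter_of_dominated_convergence (fun _ => 1)
    (Eventually.of_forall fun s => by fun_prop) ?_ (integrable_const _)
    (Eventually.of_forall fun t => ?_)
  · filter_upwards [eventually_re_pos] with s hs
    filter_upwards [ae_nonneg_iff.2 h0] with t ht
    simpa using norm_exp_neg_mul_le le_rfl hs.le ht
  · have hcont : Continuous fun s : ℂ => Complex.exp (-s * (t : ℂ)) := by fun_prop
    exact (hcont.tendsto' 0 1 (by simp)).mono_left nhdsWithin_le_nhds

theorem Stable.exists_stepResponse {F : ℂ → ℂ} (hF : Stable F)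
    (h0 : Tendsto F (𝓝[{s : ℂ | 0 < s.re}] 0) (𝓝 0)) :
    ∃ y : ℝ → ℝ, (∀ t, ContinuousWithinAt y (Ici t) t) ∧ Tendsto y atTop (𝓝 0) ∧
      ∀ s : ℂ, 0 < s.re →
        IntegrableOn (fun t : ℝ => Complex.exp (-s * (t : ℂ)) * (y t : ℂ)) (Ioi 0) ∧
        ∫ t in Ioi (0 : ℝ), Complex.exp (-s * (t : ℂ)) * (y t : ℂ) = F s / s := by
  obtain ⟨ε, hε, M, μ₁, μ₂, h₁, h₂, -, hF⟩ := hF.exists_stableWith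
  have := h₁.isFiniteMeasure hε.le
  have := h₂.isFiniteMeasure hε.le
  have hmass : μ₁.real univ - μ₂.real univ = 0 := by
    have := neBot_nhdsWithin_re_pos
    have hlim : Tendsto F (𝓝[{s : ℂ | 0 < s.re}] 0) (𝓝 (μ₁.real univ - μ₂.real univ : ℂ)) := by
      refine ((tendsto_laplace_zero h₁.1).sub (tendsto_laplace_zero h₂.1)).congr' ?_
      filter_upwards [eventually_re_pos] with s hs
        using (hF s hs.le (ne_zero_of_re_pos hs)).symm
    exact_mod_cast tendsto_nhds_unique hlim h0
  refine ⟨fun t => μ₁.real (Iic t) - μ₂.real (Iic t), fun t =>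
    (continuousWithinAt_real_Iic μ₁ t).sub (continuousWithinAt_real_Iic μ₂ t),
    hmass ▸ (tendsto_real_Iic_atTop μ₁).sub (tendsto_real_Iic_atTop μ₂), fun s hs => ?_⟩
  have i₁ := integrableOn_exp_mul_real_Iic (μ := μ₁) hs
  have i₂ := integrableOn_exp_mul_real_Iic (μ := μ₂) hs
  simp only [Complex.ofReal_sub, mul_sub]
  refine ⟨i₁.sub i₂, ?_⟩
  rw [integral_sub i₁ i₂, integral_exp_mul_real_Iic h₁.1 hs, integral_exp_mul_real_Iic h₂.1 hs,
    hF s hs.le (ne_zero_of_re_pos hs), sub_div]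

end StepResponse

section Uniqueness

theorem ae_eq_zero_of_fourier_eq_zero {μ : Measure ℝ} [SFinite μ] {v : ℝ → ℝ} (hv : Integrable v μ)
    (h : ∀ ω : ℝ, ∫ t, v t • Complex.exp (ω * t * Complex.I) ∂μ = 0) : v =ᵐ[μ] 0 := by
  have := isFiniteMeasure_withDensity_ofReal hv.2
  have : IsFiniteMeasure (μ.withDensity fun t => ENNReal.ofReal (-v t)) :=
    isFiniteMeasure_withDensity_ofReal hv.neg.2
  have hparts : μ.withDensity (fun t => ENNReal.ofReal (v t)) =
      μ.withDensity (fun t => ENNReal.ofReal (-v t)) := by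
    refine Measure.ext_of_charFun (funext fun ω => sub_eq_zero.1 ?_)
    rw [charFun_apply_real, charFun_apply_real, integral_withDensity_ofReal_sub hv.1.aemeasurable
      (by fun_prop), h ω]
    refine hv.mono (hv.1.smul (by fun_prop)) (Eventually.of_forall fun t => ?_)
    rw [norm_smul, ← Complex.ofReal_mul, Complex.norm_exp_ofReal_mul_I, mul_one]
  have hae := (withDensity_eq_iff hv.1.aemeasurable.ennreal_ofReal
    hv.1.aemeasurable.neg.ennreal_ofReal
    ((lintegral_ofReal_le_lintegral_enorm v).trans_lt hv.2).ne).1 hparts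
  filter_upwards [hae] with t ht
  have hmax := congrArg ENNReal.toReal ht
  rw [ENNReal.toReal_ofReal', ENNReal.toReal_ofReal', Pi.neg_apply, ← sub_eq_zero,
    max_zero_sub_max_neg_zero_eq_self] at hmax
  exact hmax

theorem ae_eq_zero_of_laplace_eq_zero {v : ℝ → ℝ} {σ : ℝ}
    (hi : ∀ s : ℂ, σ < s.re →
      IntegrableOn (fun t : ℝ => Complex.exp (-s * (t : ℂ)) * (v t : ℂ)) (Ioi 0))
    (h : ∀ s : ℂ, σ < s.re → ∫ t in Ioi (0 : ℝ), Complex.exp (-s * (t : ℂ)) * (v t : ℂ) = 0) :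
    v =ᵐ[volume.restrict (Ioi 0)] 0 := by
  have hw : IntegrableOn (fun t => Real.exp (-(σ + 1) * t) * v t) (Ioi 0) := by
    refine (hi (σ + 1 : ℝ) (by simp)).re.congr (Eventually.of_forall fun t => ?_)
    simp only [← Complex.ofReal_neg, ← Complex.ofReal_mul, ← Complex.ofReal_exp]
    exact Complex.ofReal_re _
  have hzero := ae_eq_zero_of_fourier_eq_zero hw fun ω => by
    rw [← h ((σ + 1 : ℝ) - ω * Complex.I) (by simp)]
    refine integral_congr_ae (Eventually.of_forall fun t => ?_)
    have hexp : Complex.exp (-((σ + 1 : ℝ) - ω * Complex.I) * t) =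
        (Real.exp (-(σ + 1) * t) : ℂ) * Complex.exp (ω * t * Complex.I) := by
      rw [Complex.ofReal_exp, ← Complex.exp_add]
      congr 1
      push_cast
      ring
    simp only [hexp, Complex.real_smul, Complex.ofReal_mul]
    ring
  filter_upwards [hzero] with t ht using (mul_eq_zero.1 ht).resolve_left (Real.exp_ne_zero _)

theorem eq_zero_of_ae_eq_zero_of_continuousWithinAt_Ici {u : ℝ → ℝ} {a t : ℝ}
    (hu : ContinuousWithinAt u (Ici t) t) (h : u =ᵐ[volume.restrict (Ioi a)] 0) (ht : a ≤ t) :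
    u t = 0 := by
  have hfreq : ∃ᶠ x in 𝓝[>] t, u x = 0 := by
    intro hev
    obtain ⟨b, hb, hsub⟩ := mem_nhdsGT_iff_exists_Ioo_subset.1 hev
    have hnull : volume (Ioo t b) = 0 := by
      rw [EventuallyEq, ae_restrict_iff' measurableSet_Ioi] at h
      refine measure_mono_null (fun x hx => ?_) (ae_iff.1 h)
      exact fun hzero => hsub hx (hzero (ht.trans_lt hx.1))
    rw [Real.volume_Ioo, ENNReal.ofReal_eq_zero, sub_nonpos] at hnull
    exact hnull.not_gt hb
  exact isClosed_singleton.mem_of_frequently_of_tendsto hfreq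
    (hu.mono_left (nhdsWithin_mono _ Ioi_subset_Ici_self))

theorem eq_of_laplace_eq {y z : ℝ → ℝ} {σ : ℝ}
    (iy : ∀ s : ℂ, σ < s.re →
      IntegrableOn (fun t : ℝ => Complex.exp (-s * (t : ℂ)) * (y t : ℂ)) (Ioi 0))
    (iz : ∀ s : ℂ, σ < s.re →
      IntegrableOn (fun t : ℝ => Complex.exp (-s * (t : ℂ)) * (z t : ℂ)) (Ioi 0))
    (h : ∀ s : ℂ, σ < s.re → ∫ t in Ioi (0 : ℝ), Complex.exp (-s * (t : ℂ)) * (y t : ℂ) =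
      ∫ t in Ioi (0 : ℝ), Complex.exp (-s * (t : ℂ)) * (z t : ℂ)) {t : ℝ} (ht : 0 ≤ t)
    (hy : ContinuousWithinAt y (Ici t) t) (hz : ContinuousWithinAt z (Ici t) t) : y t = z t := by
  refine sub_eq_zero.1 (eq_zero_of_ae_eq_zero_of_continuousWithinAt_Ici (u := fun t => y t - z t)
    (hy.sub hz) (ae_eq_zero_of_laplace_eq_zero (σ := σ) ?_ ?_) ht)
  · intro s hs
    simpa only [Complex.ofReal_sub, mul_sub] using! (iy s hs).sub (iz s hs)
  · intro s hs
    simp only [Complex.ofReal_sub, mul_sub]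
    rw [integral_sub (iy s hs) (iz s hs), h s hs, sub_self]

end Uniqueness

section DisturbanceRejection

variable {n : ℕ} {Gin Gout : Fin (n + 1) → ℂ → ℂ} {C : Fin n → ℂ → ℂ}

theorem Stable.tendsto_zero_of_div {F : ℂ → ℂ} (h : Stable (fun s => F s / s)) :
    Tendsto F (𝓝[{s : ℂ | 0 < s.re}] 0) (𝓝 0) := by
  obtain ⟨M, hM⟩ := h.exists_norm_le
  have hcont : Continuous fun s : ℂ => (M : ℝ) * ‖s‖ := by fun_prop
  refine squeeze_zero_norm' ?_ ((hcont.tendsto' 0 0 (by simp)).mono_left nhdsWithin_le_nhds)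
  filter_upwards [eventually_re_pos] with s hs
  have hs0 : s ≠ 0 := ne_zero_of_re_pos hs
  have hle : ‖F s / s‖ ≤ M := hM s hs.le hs0
  rwa [norm_div, div_le_iff₀ (norm_pos_iff.2 hs0)] at hle

theorem outputHat_apply (d : Fin (n + 3) → ℝ) (s : ℂ) (k : Fin n) :
    outputHat Gin Gout C d s k = (∑ l, (d l : ℂ) * closedLoop Gin Gout C s k l) / s := by
  rw [outputHat, Matrix.mulVec, dotProduct, Finset.sum_div]
  exact Finset.sum_congr rfl fun l _ => by ring

theorem disturbance_rejection
    (h : ∀ k l, Stable (fun s => closedLoop Gin Gout C s k l) ∧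
      Stable (fun s => closedLoop Gin Gout C s k l / s)) (d : Fin (n + 3) → ℝ) :
    Tendsto (fun s : ℂ => s • outputHat Gin Gout C d s) (𝓝[{s : ℂ | 0 < s.re}] 0) (𝓝 0) ∧
    (∃ y, IsTimeOutput (outputHat Gin Gout C d) y) ∧
    ∀ y, IsTimeOutput (outputHat Gin Gout C d) y → Tendsto y atTop (𝓝 0) := by
  let F (k : Fin n) (s : ℂ) : ℂ := ∑ l, (d l : ℂ) * closedLoop Gin Gout C s k l
  have hF (k) : Stable (F k) := Stable.sum Finset.univ fun l _ => (h k l).1.const_mul (d l)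
  have hF0 (k) : Tendsto (F k) (𝓝[{s : ℂ | 0 < s.re}] 0) (𝓝 0) :=
    Stable.tendsto_zero_of_div <|
      (Stable.sum Finset.univ fun l _ => (h k l).2.const_mul (d l)).congr fun s _ _ => by
        simp only [F, Finset.sum_div, mul_div_assoc]
  choose y hyc hylim hyL using fun k => (hF k).exists_stepResponse (hF0 k)
  refine ⟨tendsto_pi_nhds.2 fun k => (hF0 k).congr' ?_, ⟨fun t k => y k t, fun t _ =>
    continuousWithinAt_pi.2 fun k => hyc k t, 0, le_rfl, fun s hs k => ?_⟩,
    fun x ⟨hxc, σ, hσ, hxL⟩ => tendsto_pi_nhds.2 fun k => (hylim k).congr' ?_⟩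
  · filter_upwards [eventually_re_pos] with s hs
    rw [Pi.smul_apply, outputHat_apply, smul_eq_mul, mul_div_cancel₀ _ (ne_zero_of_re_pos hs)]
  · rw [outputHat_apply]
    exact hyL k s hs
  · filter_upwards [eventually_ge_atTop 0] with t ht
    refine eq_of_laplace_eq (σ := σ) (fun s hs => (hyL k s (hσ.trans_lt hs)).1)
      (fun s hs => (hxL s hs k).1) (fun s hs => ?_) ht (hyc k t)
      (continuousWithinAt_pi.1 (hxc t ht) k)
    rw [(hyL k s (hσ.trans_lt hs)).2, (hxL s hs k).2, outputHat_apply]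

end DisturbanceRejection

end Channel

end

theorem theorem1 {n : ℕ} (Gin Gout : Fin (n + 1) → ℂ → ℂ) (c : Fin (n + 1) → ℝ)
    (hc : ∀ j, 0 < c j)
    (hin : ∀ j, Channel.HasIntegrator (Gin j) (1 / c j))
    (hout : ∀ j, Channel.HasIntegrator (Gout j) (-(1 / c j)))
    (ν : Equiv.Perm (Fin n)) (φ : ℝ) (hφ₀ : 0 < φ) (hφ₁ : φ < 90) :
    -- every step of the procedure is feasible, whatever stabilizing compensators were chosen before
    (∀ (m : Fin n) (C : Fin n → ℂ → ℂ),
      (∀ p : Fin n, p < m → Channel.IsPI (C (ν p)) ∧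
        Channel.ClosedLoopStable (Channel.stepPlant Gin Gout ν C p) (C (ν p))) →
      ∃ Cm : ℂ → ℂ, Channel.IsPI Cm ∧
        Channel.ClosedLoopStable (Channel.stepPlant Gin Gout ν C m) Cm ∧
        Channel.HasPhaseMargin (Channel.stepPlant Gin Gout ν C m) Cm φ) ∧
    -- every outcome of the procedure stabilizes the MIMO loop and rejects constant disturbances
    (∀ C : Fin n → ℂ → ℂ,
      (∀ m : Fin n, Channel.IsPI (C (ν m)) ∧
        Channel.ClosedLoopStable (Channel.stepPlant Gin Gout ν C m) (C (ν m))) →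
      (∀ s : ℂ, 0 ≤ s.re → s ≠ 0 → IsUnit (Channel.loopMatrix Gin Gout C s)) ∧
      (∀ k l, Channel.Stable (fun s => Channel.closedLoop Gin Gout C s k l)) ∧
      ∀ d : Fin (n + 3) → ℝ,
        Filter.Tendsto (fun s : ℂ => s • Channel.outputHat Gin Gout C d s)
          (nhdsWithin 0 {s : ℂ | 0 < s.re}) (nhds 0) ∧
        (∃ y, Channel.IsTimeOutput (Channel.outputHat Gin Gout C d) y) ∧
        ∀ y, Channel.IsTimeOutput (Channel.outputHat Gin Gout C d) y →
          Filter.Tendsto y Filter.atTop (nhds 0)) := by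
  have ha : ∀ j, 0 < 1 / c j := fun j => one_div_pos.2 (hc j)
  refine ⟨fun m C h => ?_, fun C h => ?_⟩
  · obtain ⟨g, hg, hP⟩ := Channel.exists_hasIntegrator_stepPlant ha hin hout h
    exact Channel.exists_PI_phaseMargin hg hP hφ₀ hφ₁
  · obtain ⟨hU, hS⟩ := Channel.isUnit_loopMatrix_and_stable_closedLoop ha hin hout h
    exact ⟨hU, fun k l => (hS k l).1, Channel.disturbance_rejection hS⟩
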